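/- Let $(\Omega,\mathcal F,\mu)$ be a $\sigma$-finite measure space, $W\colon\Omega\times\Omega\to[0,1]$ symmetric and measurable, $S\colon\Omega\to[0,\infty)$ measurable, and $I\in[0,\infty)$; write $\mathbb W=(W,S,I,\Omega)$. For measurable $\Omega'\subseteq\Omega$ let $\mathbb W|_{\Omega'}$ (and $W|_{\Omega'}$) be the restriction of $\mathbb W$ (of $W$) to $\Omega'$ (to $\Omega'\times\Omega'$), and call $\mathbb W$ integrable if $$\|\mathbb W\|_1=\int_{\Omega\times\Omega}W\,d\mu\,d\mu+2\int_\Omega S\,d\mu+2I<\infty .$$ Put $D_W(x)=\int_\Omega W(x,y)\,d\mu(y)\in[0,\infty]$ and $D_{\mathbb W}(x)=D_W(x)+S(x)$. Consider the conditions (1) $W(\cdot,x)$ is integrable for almost all $x\in\Omega$; (2) there is a measurable $\Omega'\subseteq\Omega$ with $\mu(\Omega\setminus\Omega')<\infty$ such that $\mathbb W|_{\Omega'}$ is integrable. Let $\lambda$ be Lebesgue measure on $\mathbb R_+=[0,\infty)$, and let $\mathcal G_\infty(\mathbb W)$ be the random graph with vertices labeled by $\mathbb R_+$ obtained as follows.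 Take a Poisson point process on $\mathbb R_+\times\Omega$ with intensity $\lambda\times\mu$; join any two of its points $(t,x),(t',x')$ with probability $W(x,x')$, independently for all pairs; for every point $(t,x)$ take a further independent Poisson process on $\mathbb R_+$ with intensity $S(x)\lambda$ and join $(t,x)$ to a new vertex with label $s$ for each of its points $s$; take a further independent Poisson process on $\mathbb R_+^2$ with intensity $I(\lambda\times\lambda)$ and for each of its points $(s,s')$ add an isolated edge between vertices with labels $s$ and $s'$; finally keep only the labels in $\mathbb R_+$ and delete the vertices of degree zero. The adjacency measure generated by $\mathbb W$ is the random measure $\xi[\mathbb W]=\sum_{(t,t')}\delta_{(t,t')}$ on $\mathbb R_+^2$, the sum being over all ordered pairs of adjacent vertices of $\mathcal G_\infty(\mathbb W)$. Then (1) and (2) both hold if and only if almost surely $\xi[\mathbb W]$ is locally finite, i.e. almost surely $\xi[\mathbb W](A)<\infty$ for all bounded Borel sets $A\subset\mathbb R_+^2$. Moreover, if (1) holds, then the following are equivalent: (A) condition (2) holds; (B) for all $D>0$, $\mu(\{D_{\mathbb W}>D\})<\infty$ and $\mathbb W|_{\{D_{\mathbb W}\le D\}}$ is integrable; (C) there exists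 $D>0$ such that $\mu(\{D_{\mathbb W}>D\})<\infty$ and $\mathbb W|_{\{D_{\mathbb W}\le D\}}$ is integrable; (D) for all $D>0$, $\mu(\{D_W>D\})<\infty$, and both $W|_{\{D_W\le D\}}$ and $\min\{S,1\}$ are integrable; (E) there exists $D>0$ such that $\mu(\{D_W>D\})<\infty$, and both $W|_{\{D_W\le D\}}$ and $\min\{S,1\}$ are integrable. -/

import Mathlib

open MeasureTheory
open scoped ENNReal NNReal

noncomputable section

namespace Graphex

/-- Lebesgue measure on `ℝ₊`. -/
def lebesgue : Measure ℝ≥0 := (volume : Measure ℝ).comap ((↑) : ℝ≥0 → ℝ)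

instance : SigmaFinite lebesgue where
  out' := ⟨{
    set := fun n : ℕ => Set.Iic (n : ℝ≥0)
    set_mem := fun _ => trivial
    finite := fun n => by
      have hle : (((↑) : ℝ≥0 → ℝ) '' Set.Iic (n : ℝ≥0)) ⊆ Set.Icc (0 : ℝ) n := by
        rintro _ ⟨x, hx, rfl⟩
        exact ⟨x.2, by exact_mod_cast (Set.mem_Iic.1 hx)⟩
      have hemb : MeasurableEmbedding ((↑) : ℝ≥0 → ℝ) :=
        MeasurableEmbedding.subtype_coe measurableSet_Ici
      rw [lebesgue, hemb.comap_apply]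
      exact (measure_mono hle).trans_lt measure_Icc_lt_top
    spanning := Set.eq_univ_of_forall fun x => by
      obtain ⟨n, hn⟩ := exists_nat_ge x
      exact Set.mem_iUnion.2 ⟨n, hn⟩ }⟩

/-! ### Poisson point processes on an s-finite measure space -/

/-- A finite configuration of points in `X`, listed in some order. -/
abbrev FiniteConfig (X : Type*) : Type _ := Σ k : ℕ, (Fin k → X)

/-- The law of the Poisson point process with finite intensity measure `ν`: on configurations of
`k` points it is `exp (-ν X) / k! • ν ^ k`. In other words, the number of points is Poisson with
mean `ν X` and, given their number, the points are i.i.d. with law `ν / ν X`. -/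
def finitePoissonLaw {X : Type*} [MeasurableSpace X] (ν : Measure X) [IsFiniteMeasure ν] :
    Measure (FiniteConfig X) :=
  Measure.sum fun k : ℕ =>
    ENNReal.ofReal (Real.exp (-ν.real Set.univ) / (k.factorial : ℝ)) •
      (Measure.pi fun _ : Fin k => ν).map (fun x => (⟨k, x⟩ : FiniteConfig X))

lemma measurable_mkConfig {X : Type*} [MeasurableSpace X] (k : ℕ) :
    Measurable (fun x : Fin k → X => (⟨k, x⟩ : FiniteConfig X)) :=
  measurable_iff_le_map.2 (iInf_le _ k)

instance {X : Type*} [MeasurableSpace X] (ν : Measure X) [IsFiniteMeasure ν] :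
    IsProbabilityMeasure (finitePoissonLaw ν) where
  measure_univ := by
    have hm : ν Set.univ = ENNReal.ofReal (ν.real Set.univ) := by
      simp [Measure.real]
    have hnn : 0 ≤ ν.real Set.univ := measureReal_nonneg
    generalize ν.real Set.univ = m at hm hnn
    have hterm : ∀ k : ℕ,
        (ENNReal.ofReal (Real.exp (-m) / (k.factorial : ℝ)) •
          (Measure.pi fun _ : Fin k => ν).map
            (fun x => (⟨k, x⟩ : FiniteConfig X))) Set.univ
          = ENNReal.ofReal (Real.exp (-m) * (m ^ k / (k.factorial : ℝ))) := by
      intro k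
      rw [Measure.smul_apply, Measure.map_apply (measurable_mkConfig k) MeasurableSet.univ,
        Set.preimage_univ, Measure.pi_univ]
      simp only [Finset.prod_const, Finset.card_univ, Fintype.card_fin, smul_eq_mul]
      rw [hm, ← ENNReal.ofReal_pow hnn, ← ENNReal.ofReal_mul (by positivity)]
      congr 1
      ring
    have hs : HasSum (fun k : ℕ => Real.exp (-m) * (m ^ k / (k.factorial : ℝ))) 1 := by
      have h := (NormedSpace.expSeries_div_hasSum_exp m).mul_left (Real.exp (-m))
      rwa [← Real.exp_eq_exp_ℝ, ← Real.exp_add, neg_add_cancel, Real.exp_zero] at h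
    have hreal : ν.real Set.univ = m := by
      rw [Measure.real, hm, ENNReal.toReal_ofReal hnn]
    rw [finitePoissonLaw, Measure.sum_apply _ MeasurableSet.univ, hreal]
    simp_rw [hterm]
    rw [← ENNReal.ofReal_tsum_of_nonneg (fun k => by positivity) hs.summable, hs.tsum_eq]
    simp

/-- A configuration of points in `X`, presented as a countable superposition of finite ones. -/
abbrev Config (X : Type*) : Type _ := ℕ → FiniteConfig X

/-- The index set of the points of a configuration. -/
abbrev Config.Index {X : Type*} (c : Config X) : Type := Σ n : ℕ, Fin (c n).1

/-- The point of a configuration with a given index. -/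
def Config.point {X : Type*} (c : Config X) (p : c.Index) : X := (c p.1).2 p.2

/-- The label in `ℕ × ℕ` of an index (distinct indices have distinct labels). -/
def Config.label {X : Type*} (c : Config X) (p : c.Index) : ℕ × ℕ := (p.1, (p.2 : ℕ))

/-- The law of the Poisson point process with s-finite (e.g. σ-finite) intensity measure `ν`:
write `ν` as a countable sum of finite measures and superpose independent Poisson point processes
with these finite intensities. -/
def poissonLaw {X : Type*} [MeasurableSpace X] (ν : Measure X) [SFinite ν] :
    Measure (Config X) :=
  Measure.infinitePi fun n : ℕ => finitePoissonLaw (sfiniteSeq ν n)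

instance {X : Type*} [MeasurableSpace X] (ν : Measure X) [SFinite ν] :
    IsProbabilityMeasure (poissonLaw ν) := by
  unfold poissonLaw; infer_instance

/-! ### Quadruples `(W, S, I, Ω)` -/

/-- The data `(W, S, I)` of a graphex over the measurable space `Ω`, without any local finiteness
condition. The measure `μ` on `Ω` is kept separate. -/
structure Data (Ω : Type*) [MeasurableSpace Ω] where
  W : Ω → Ω → ℝ≥0
  S : Ω → ℝ≥0
  I : ℝ≥0
  measurable_W : Measurable (Function.uncurry W)
  symm_W : ∀ x y, W x y = W y x
  W_le_one : ∀ x y, W x y ≤ 1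
  measurable_S : Measurable S

namespace Data

variable {Ω : Type*} [MeasurableSpace Ω]

/-- The restriction of the quadruple to a subset `A` of `Ω`; the underlying measure on the
subspace `A` is `μ.comap (↑)`. -/
def restrict (𝕎 : Data Ω) (A : Set Ω) : Data A where
  W x y := 𝕎.W x y
  S x := 𝕎.S x
  I := 𝕎.I
  measurable_W := 𝕎.measurable_W.comp
    ((measurable_subtype_coe.comp measurable_fst).prodMk
      (measurable_subtype_coe.comp measurable_snd))
  symm_W x y := 𝕎.symm_W x y
  W_le_one x y := 𝕎.W_le_one x y
  measurable_S := 𝕎.measurable_S.comp measurable_subtype_coe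

/-- `‖𝕎‖₁ = ∫∫ W + 2 ∫ S + 2 I`. -/
def norm1 (𝕎 : Data Ω) (μ : Measure Ω) : ℝ≥0∞ :=
  (∫⁻ p : Ω × Ω, (𝕎.W p.1 p.2 : ℝ≥0∞) ∂(μ.prod μ)) + 2 * (∫⁻ x, (𝕎.S x : ℝ≥0∞) ∂μ) +
    2 * (𝕎.I : ℝ≥0∞)

/-- The quadruple is integrable: `‖𝕎‖₁ < ∞`. -/
def IsIntegrable (𝕎 : Data Ω) (μ : Measure Ω) : Prop := 𝕎.norm1 μ < ∞

/-- The graphon part `W` is integrable on `Ω × Ω`. -/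
def GraphonIntegrable (𝕎 : Data Ω) (μ : Measure Ω) : Prop :=
  Integrable (fun p : Ω × Ω => (𝕎.W p.1 p.2 : ℝ)) (μ.prod μ)

/-- The marginal `D_W` of the graphon part. -/
def degW (𝕎 : Data Ω) (μ : Measure Ω) (x : Ω) : ℝ≥0∞ := ∫⁻ y, (𝕎.W x y : ℝ≥0∞) ∂μ

/-- The marginal `D_𝕎 = D_W + S`. -/
def deg (𝕎 : Data Ω) (μ : Measure Ω) (x : Ω) : ℝ≥0∞ := 𝕎.degW μ x + (𝕎.S x : ℝ≥0∞)

/-- Local finiteness condition (1): `W(·, x)` is integrable for almost all `x`. -/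
def LocallyFinite₁ (𝕎 : Data Ω) (μ : Measure Ω) : Prop :=
  ∀ᵐ x ∂μ, Integrable (fun y => (𝕎.W y x : ℝ)) μ

/-- Local finiteness condition (2): the restriction to some measurable set with complement of
finite measure is integrable. -/
def LocallyFinite₂ (𝕎 : Data Ω) (μ : Measure Ω) : Prop :=
  ∃ A : Set Ω, MeasurableSet A ∧ μ Aᶜ < ∞ ∧
    (𝕎.restrict A).IsIntegrable (μ.comap ((↑) : A → Ω))

/-! ### The graph generated by a quadruple -/

/-- The sample space of the randomness used to generate the infinite graph: the points `(t, x)`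
(birth time and feature) of a Poisson process on `ℝ₊ × Ω`, for each unordered pair of labels a
random number in `[0,1]`, for each label of a point a Poisson process on `ℝ₊ × ℝ₊`
(times and heights), and the Poisson process on `ℝ₊ × ℝ₊` of isolated edges. -/
abbrev Outcome (Ω : Type*) : Type _ :=
  Config (ℝ≥0 × Ω) × (Sym2 (ℕ × ℕ) → unitInterval) ×
    (ℕ × ℕ → Config (ℝ≥0 × ℝ≥0)) × Config (ℝ≥0 × ℝ≥0)

abbrev Outcome.points (ω : Outcome Ω) : Config (ℝ≥0 × Ω) := ω.1

abbrev Outcome.coins (ω : Outcome Ω) : Sym2 (ℕ × ℕ) → unitInterval := ω.2.1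

abbrev Outcome.stars (ω : Outcome Ω) : ℕ × ℕ → Config (ℝ≥0 × ℝ≥0) := ω.2.2.1

abbrev Outcome.dust (ω : Outcome Ω) : Config (ℝ≥0 × ℝ≥0) := ω.2.2.2

/-- The relation on `ℝ₊` given by the edges of the generated graph.
* Two distinct points `(t, x)`, `(t', x')` of the Poisson process are joined if the uniform random
variable of the pair is smaller than `W x x'`, an event of probability `W x x'`.
* A point `(t, x)` is joined to a leaf with birth time `s` for each point `(s, h)` of its own unit
rate Poisson process on `ℝ₊ × ℝ₊` with `h < S x`; these times `s` form a Poisson process on `ℝ₊`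
with intensity `S x` times Lebesgue measure.
* Each point `(s, s')` of the dust process gives an edge between `s` and `s'`. -/
def edgeRel (𝕎 : Data Ω) (ω : Outcome Ω) (a b : ℝ≥0) : Prop :=
  (∃ p q : ω.points.Index, p ≠ q ∧ a = (ω.points.point p).1 ∧ b = (ω.points.point q).1 ∧
    (ω.coins s(ω.points.label p, ω.points.label q) : ℝ) <
      (𝕎.W (ω.points.point p).2 (ω.points.point q).2 : ℝ)) ∨
  (∃ p : ω.points.Index, a = (ω.points.point p).1 ∧
    ∃ q : (ω.stars (ω.points.label p)).Index,
      ((ω.stars (ω.points.label p)).point q).2 < 𝕎.S (ω.points.point p).2 ∧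
      b = ((ω.stars (ω.points.label p)).point q).1) ∨
  (∃ q : ω.dust.Index, a = (ω.dust.point q).1 ∧ b = (ω.dust.point q).2)

/-- The infinite graph generated by the quadruple, with vertices labeled by their birth times.
Elements of `ℝ₊` without neighbors are not regarded as vertices. -/
def graph (𝕎 : Data Ω) (ω : Outcome Ω) : SimpleGraph ℝ≥0 :=
  SimpleGraph.fromRel (𝕎.edgeRel ω)

/-- The law of the randomness: all ingredients are independent, the points form a Poisson process
with intensity `λ × μ`, the coins are uniform on `[0,1]`, each star process is Poisson with
intensity `λ × λ`, and the dust process is Poisson with intensity `I (λ × λ)`. -/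
def sampleLaw (𝕎 : Data Ω) (μ : Measure Ω) [SigmaFinite μ] :
    Measure (Outcome Ω) :=
  (poissonLaw (lebesgue.prod μ)).prod
    ((Measure.infinitePi fun _ : Sym2 (ℕ × ℕ) => (volume : Measure unitInterval)).prod
      ((Measure.infinitePi fun _ : ℕ × ℕ =>
          poissonLaw (lebesgue.prod lebesgue)).prod
        (poissonLaw (𝕎.I • lebesgue.prod lebesgue))))

end Data

/-- The adjacency measure of a graph with vertices in `ℝ₊`: the sum of the unit point masses at
`(t, t')` over all ordered pairs of adjacent vertices. -/
def adjacencyMeasure (G : SimpleGraph ℝ≥0) : Measure (ℝ≥0 × ℝ≥0) :=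
  Measure.sum fun e : {e : ℝ≥0 × ℝ≥0 // G.Adj e.1 e.2} => Measure.dirac (e : ℝ≥0 × ℝ≥0)

/-- A measure on `ℝ₊²` is locally finite if bounded Borel sets have finite measure. -/
def LocallyFiniteMeasure (ξ : Measure (ℝ≥0 × ℝ≥0)) : Prop :=
  ∀ A : Set (ℝ≥0 × ℝ≥0), MeasurableSet A → Bornology.IsBounded A → ξ A < ∞

end Graphex

end

/-!
For a Poisson process with intensity `ν`, sums over points are governed by two formulas: the Mecke
formula `E ∑ₚ F(p, c ∖ p) = ∫ E F(z, c) dν(z)` (`mecke_poissonLaw`) and the bound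
`E exp (-∑ₚ f(p)) ≤ exp (-(∫ f dν) / 2)` for `0 ≤ f ≤ 1` (`lintegral_expNeg_config_sum_le`). Both
are first proved for finite intensities and then transferred to the countable superposition that
defines `poissonLaw`.

Conditions (1) and (2) imply local finiteness by first moments (`Data.ae_locallyFinite`). If `A` is
the set of condition (2), then up to a fixed time the expected numbers of edges inside `A` and of
leaves at `A` are finite, and there are only finitely many points outside of `A`. By (1) these have
finite marginals, hence marginals below some `k`, and for each `k` the expected number of edges and
leaves at points outside of `A` with marginals below `k` is finite as well.

Conversely (`Data.locallyFinite_of_ae`), let the graph be a.s. locally finite. Given the points, the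
edges are independent, so by the second Borel–Cantelli lemma the conditional expectation
`Q = ∑ W(x, x')` of the number of ordered edges up to time `1` is a.s. finite, and so is
`∑ min (S x) 1`; the latter gives the integrability of `min S 1` by means of the Laplace transform.
Condition (1) holds since a point with `D_W = ∞` would have `∑ W = ∞` over its potential neighbors.
Next choose `K` with `P(Q > K) < 1 / 4`.
* If `D_W ≥ 20` on `E`, then typically most points in `E` contribute at least `1` to `Q`, so `μ E`
  is bounded in terms of `K` (`Data.measure_le_of_degW_gt`).
* For vertices with `D_W ≤ 20`, the Mecke formula for pairs of points expresses
  `E[∑ W(x, x'); Q ≤ L]`, which is at most `L`, as the integral of `W(x, x')` times the probability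
  that the configuration with `x` and `x'` added satisfies `Q ≤ L`. For `L = K + 642` this
  probability is at least `1 / 2`, so `∫∫ W` is at most `2 L` on these vertices
  (`Data.massW_le_of_measure_expectedEdges_gt`).

The set where `D_W ≤ 20` and `S ≤ 1` is then a witness for condition (2).

The equivalence of the five deterministic conditions is `Data.tfae_locallyFinite₂`. Its main point
is `Data.measure_degW_gt_lt_top`, where (1) is used to find a bounded-degree part of the complement of
`A` that misses only a set of small measure.
-/

noncomputable section

namespace Graphex

/-! ### The decreasing exponential on `[0, ∞]` -/

/-- The function `y ↦ exp (-y)` on `[0, ∞]`, with value `0` at `∞`. -/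
def expNeg (y : ℝ≥0∞) : ℝ≥0∞ := (EReal.exp (y : EReal))⁻¹

@[simp] lemma expNeg_zero : expNeg 0 = 1 := by simp [expNeg]

@[simp] lemma expNeg_top : expNeg ∞ = 0 := by simp [expNeg]

lemma expNeg_add (a b : ℝ≥0∞) : expNeg (a + b) = expNeg a * expNeg b := by
  have h (y : ℝ≥0∞) : EReal.exp (y : EReal) ≠ 0 := by simp
  rw [expNeg, EReal.coe_ennreal_add, EReal.exp_add, ENNReal.mul_inv (.inl (h a)) (.inr (h b))]
  rfl

lemma expNeg_anti : Antitone expNeg := fun a b h => by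
  simpa [expNeg] using h

lemma expNeg_le_one (y : ℝ≥0∞) : expNeg y ≤ 1 := by
  simpa using expNeg_anti (zero_le : (0 : ℝ≥0∞) ≤ y)

lemma expNeg_eq_zero {y : ℝ≥0∞} : expNeg y = 0 ↔ y = ∞ := by
  simp [expNeg]

lemma expNeg_ofReal {r : ℝ} (hr : 0 ≤ r) :
    expNeg (ENNReal.ofReal r) = ENNReal.ofReal (Real.exp (-r)) := by
  rw [expNeg, EReal.coe_ennreal_ofReal, max_eq_left hr, EReal.exp_coe,
    ← ENNReal.ofReal_inv_of_pos (Real.exp_pos _), Real.exp_neg]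

lemma continuous_expNeg : Continuous expNeg :=
  (ENNReal.continuous_exp.comp continuous_coe_ennreal_ereal).inv

lemma measurable_expNeg : Measurable expNeg := continuous_expNeg.measurable

lemma expNeg_sum {ι : Type*} (s : Finset ι) (f : ι → ℝ≥0∞) :
    expNeg (∑ i ∈ s, f i) = ∏ i ∈ s, expNeg (f i) := by
  classical
  induction s using Finset.induction_on with
  | empty => simp
  | insert a s ha ih => rw [Finset.sum_insert ha, Finset.prod_insert ha, expNeg_add, ih]

/-- By convexity, `exp (-y) ≤ 1 - y / 2` on `[0, 1]`. -/
lemma expNeg_add_half_le {y : ℝ≥0∞} (hy : y ≤ 1) : expNeg y + y / 2 ≤ 1 := by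
  obtain ⟨r, hr, rfl⟩ : ∃ r : ℝ, 0 ≤ r ∧ y = ENNReal.ofReal r :=
    ⟨y.toReal, ENNReal.toReal_nonneg,
      (ENNReal.ofReal_toReal (ne_top_of_le_ne_top (by simp) hy)).symm⟩
  have hr1 : r ≤ 1 := by simpa using hy
  have h2 : ENNReal.ofReal r / 2 = ENNReal.ofReal (r / 2) := by
    rw [ENNReal.ofReal_div_of_pos (by norm_num)]; simp
  rw [expNeg_ofReal hr, h2, ← ENNReal.ofReal_add (Real.exp_pos _).le (by positivity),
    ENNReal.ofReal_le_one]
  have h1 : (1 + r) * Real.exp (-r) ≤ 1 := by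
    have := mul_le_mul_of_nonneg_right (Real.add_one_le_exp r) (Real.exp_pos (-r)).le
    rw [← Real.exp_add, add_neg_cancel, Real.exp_zero] at this
    linarith
  have h3 := Real.exp_pos (-r)
  nlinarith

lemma expNeg_le_one_sub_half {y : ℝ≥0∞} (hy : y ≤ 1) : expNeg y ≤ 1 - y / 2 :=
  ENNReal.le_sub_of_add_le_right (ENNReal.div_ne_top (ne_top_of_le_ne_top (by simp) hy) (by simp))
    (expNeg_add_half_le hy)

lemma one_sub_le_expNeg (y : ℝ≥0∞) : 1 - y ≤ expNeg y := by
  rcases le_total 1 y with h | h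
  · simp [tsub_eq_zero_of_le h]
  · obtain ⟨r, hr, rfl⟩ : ∃ r : ℝ, 0 ≤ r ∧ y = ENNReal.ofReal r :=
      ⟨y.toReal, ENNReal.toReal_nonneg,
        (ENNReal.ofReal_toReal (ne_top_of_le_ne_top (by simp) h)).symm⟩
    rw [expNeg_ofReal hr, ← ENNReal.ofReal_one, ← ENNReal.ofReal_sub _ hr]
    exact ENNReal.ofReal_le_ofReal (by have := Real.add_one_le_exp (-r); linarith)

/-- A random variable whose Laplace transform vanishes is a.s. infinite. -/
lemma ae_eq_top_of_lintegral_expNeg {α : Type*} [MeasurableSpace α] {P : Measure α}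
    {X : α → ℝ≥0∞} (hX : Measurable X) (h : ∫⁻ a, expNeg (X a) ∂P = 0) : ∀ᵐ a ∂P, X a = ∞ := by
  have h := (lintegral_eq_zero_iff (measurable_expNeg.comp hX)).1 h
  filter_upwards [h] with a ha
  exact expNeg_eq_zero.1 ha

/-- Superposition principle for Laplace transforms: under a product measure, the Laplace transform
of a sum of functions of the single coordinates is at most the product of the bounds for the
summands. -/
lemma lintegral_expNeg_tsum_le {ι : Type*} {X : ι → Type*} [∀ i, MeasurableSpace (X i)]
    (P : ∀ i, Measure (X i)) [∀ i, IsProbabilityMeasure (P i)] {Y : ∀ i, X i → ℝ≥0∞}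
    (hY : ∀ i, Measurable (Y i)) {a : ι → ℝ≥0∞}
    (h : ∀ i, ∫⁻ x, expNeg (Y i x) ∂(P i) ≤ expNeg (a i)) :
    ∫⁻ ω, expNeg (∑' i, Y i (ω i)) ∂(Measure.infinitePi P) ≤ expNeg (∑' i, a i) := by
  have hfin (s : Finset ι) :
      ∫⁻ ω, expNeg (∑' i, Y i (ω i)) ∂(Measure.infinitePi P) ≤ expNeg (∑ i ∈ s, a i) := by
    have hind : ProbabilityTheory.iIndepFun (fun i (ω : ∀ i, X i) => expNeg (Y i (ω i)))
        (Measure.infinitePi P) :=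
      ProbabilityTheory.iIndepFun_infinitePi (X := fun i x => expNeg (Y i x))
        (fun i => measurable_expNeg.comp (hY i))
    calc ∫⁻ ω, expNeg (∑' i, Y i (ω i)) ∂(Measure.infinitePi P)
        ≤ ∫⁻ ω, ∏ i ∈ s, expNeg (Y i (ω i)) ∂(Measure.infinitePi P) := by
          refine lintegral_mono fun ω => ?_
          rw [← expNeg_sum]
          exact expNeg_anti (ENNReal.sum_le_tsum s)
      _ = ∏ i ∈ s, ∫⁻ ω, expNeg (Y i (ω i)) ∂(Measure.infinitePi P) := by
          have := ProbabilityTheory.lintegral_prod_eq_prod_lintegral_of_indepFun s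
            (fun i (ω : ∀ i, X i) => expNeg (Y i (ω i))) hind
            (fun i => measurable_expNeg.comp ((hY i).comp (measurable_pi_apply i)))
          simpa using this
      _ ≤ ∏ i ∈ s, expNeg (a i) := by
          refine Finset.prod_le_prod' fun i _ => ?_
          refine le_trans (le_of_eq ?_) (h i)
          exact (measurePreserving_eval_infinitePi P i).lintegral_comp
            (measurable_expNeg.comp (hY i))
      _ = expNeg (∑ i ∈ s, a i) := (expNeg_sum s a).symm
  have hlim := (continuous_expNeg.tendsto _).comp (ENNReal.summable (f := a)).hasSum
  exact ge_of_tendsto' hlim hfin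

/-- Independent events whose probabilities have infinite sum: a form of the second Borel–Cantelli
lemma on a product space, for an arbitrary index set. -/
lemma ae_infinite_of_tsum_eq_top {ι : Type*} [Countable ι] {X : ι → Type*}
    [∀ i, MeasurableSpace (X i)]
    (P : ∀ i, Measure (X i)) [∀ i, IsProbabilityMeasure (P i)] {A : ∀ i, Set (X i)}
    (hA : ∀ i, MeasurableSet (A i)) (h : ∑' i, P i (A i) = ∞) :
    ∀ᵐ ω ∂(Measure.infinitePi P), {i | ω i ∈ A i}.Infinite := by
  have hY (i) : Measurable ((A i).indicator (1 : X i → ℝ≥0∞)) := measurable_one.indicator (hA i)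
  have hle := lintegral_expNeg_tsum_le P hY (a := fun i => P i (A i) / 2) fun i => by
    calc ∫⁻ x, expNeg ((A i).indicator 1 x) ∂(P i)
        ≤ ∫⁻ x, (1 - (A i).indicator 1 x / 2) ∂(P i) :=
          lintegral_mono fun x => expNeg_le_one_sub_half
            (Set.indicator_le_self' (by simp) x |>.trans (by simp))
      _ = 1 - P i (A i) / 2 := by
          rw [lintegral_sub]
          · simp [div_eq_mul_inv, lintegral_mul_const _ (hY i), lintegral_indicator_one (hA i)]
          · exact (hY i).div_const 2
          · simp only [div_eq_mul_inv, lintegral_mul_const _ (hY i),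
              lintegral_indicator_one (hA i)]
            exact ENNReal.mul_ne_top (measure_ne_top _ _) (by simp)
          · refine .of_forall fun x => ?_
            have h1 : (A i).indicator (1 : X i → ℝ≥0∞) x ≤ 1 :=
              Set.indicator_le_self' (by simp) x |>.trans (by simp)
            exact (ENNReal.half_le_self).trans h1
      _ ≤ _ := one_sub_le_expNeg _
  have hsum : ∑' i, P i (A i) / 2 = ∞ := by
    simp [div_eq_mul_inv, ENNReal.tsum_mul_right, h]
  rw [hsum, expNeg_top, nonpos_iff_eq_zero] at hle
  have hmeas : Measurable fun ω : ∀ i, X i => ∑' i, (A i).indicator (1 : X i → ℝ≥0∞) (ω i) :=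
    Measurable.tsum fun i => (hY i).comp (measurable_pi_apply i)
  filter_upwards [ae_eq_top_of_lintegral_expNeg hmeas hle] with ω hω hfin
  refine (ENNReal.sum_lt_top (s := hfin.toFinset) (f := fun i => (A i).indicator 1 (ω i))).2
    (fun i _ => ?_) |>.ne ?_
  · exact (Set.indicator_le_self' (by simp) (ω i) |>.trans (by simp : _ ≤ (1 : ℝ≥0∞))).trans_lt
      (by simp)
  · rw [← hω]
    refine (tsum_eq_sum fun i hi => ?_).symm
    have : ω i ∉ A i := by simpa using hi
    simp [this]

lemma exists_nat_measure_gt_lt {α : Type*} [MeasurableSpace α] (P : Measure α) [IsFiniteMeasure P]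
    {f : α → ℝ≥0∞} (hf : Measurable f) (h : ∀ᵐ a ∂P, f a < ∞) {ε : ℝ≥0∞} (hε : ε ≠ 0) :
    ∃ k : ℕ, P {a | (k : ℝ≥0∞) < f a} < ε := by
  have hlim : Filter.Tendsto (fun k : ℕ => P {a | (k : ℝ≥0∞) < f a}) Filter.atTop
      (nhds (P (⋂ k : ℕ, {a | (k : ℝ≥0∞) < f a}))) := by
    refine tendsto_measure_iInter_atTop (fun k => ?_) ?_ ⟨0, measure_ne_top _ _⟩
    · exact (measurableSet_lt measurable_const hf).nullMeasurableSet
    · intro i j hij x hx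
      exact lt_of_le_of_lt (Nat.cast_le.2 hij) (show (j : ℝ≥0∞) < f x from hx)
  have h0 : P (⋂ k : ℕ, {a | (k : ℝ≥0∞) < f a}) = 0 := by
    refine measure_mono_null (fun x hx => ?_) (ae_iff.1 h)
    intro (hfin : f x < ∞)
    obtain ⟨n, hn⟩ := ENNReal.exists_nat_gt hfin.ne
    exact absurd hn (not_lt.2 (le_of_lt (Set.mem_iInter.1 hx n)))
  rw [h0] at hlim
  exact (hlim.eventually_lt_const (pos_iff_ne_zero.2 hε)).exists

/-! ### Sums over the points of a configuration -/

lemma measurableEmbedding_mkConfig {X : Type*} [MeasurableSpace X] (k : ℕ) :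
    MeasurableEmbedding (fun x : Fin k → X => (⟨k, x⟩ : FiniteConfig X)) where
  injective := sigma_mk_injective (β := fun k => Fin k → X)
  measurable := measurable_mkConfig k
  measurableSet_image' := fun A hA => by
    refine MeasurableSpace.measurableSet_iInf.2 fun j => ?_
    let mk (l : ℕ) : (Fin l → X) → FiniteConfig X := fun x => ⟨l, x⟩
    change MeasurableSet (mk j ⁻¹' (mk k '' A))
    rcases eq_or_ne j k with rfl | h
    · have hinj : (mk j).Injective := sigma_mk_injective (β := fun k => Fin k → X)
      rwa [Set.preimage_image_eq _ hinj]
    · have : mk j ⁻¹' (mk k '' A) = ∅ := by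
        refine Set.eq_empty_of_forall_notMem fun x hx => ?_
        obtain ⟨y, -, hy⟩ := hx
        exact h (congrArg Sigma.fst hy).symm
      rw [this]
      exact MeasurableSet.empty

/-- Joint measurability on `FiniteConfig X × Z` can be checked separately for each number of
points. -/
lemma measurable_finiteConfig_prod {X Z β : Type*} [MeasurableSpace X] [MeasurableSpace Z]
    [MeasurableSpace β] {f : FiniteConfig X × Z → β}
    (h : ∀ k, Measurable fun q : (Fin k → X) × Z => f (⟨k, q.1⟩, q.2)) : Measurable f := by
  intro S hS
  have hU : f ⁻¹' S = ⋃ k, Prod.map (fun x : Fin k → X => (⟨k, x⟩ : FiniteConfig X)) id ''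
      ((fun q : (Fin k → X) × Z => f (⟨k, q.1⟩, q.2)) ⁻¹' S) := by
    ext ⟨⟨k, x⟩, z⟩
    simp only [Set.mem_preimage, Set.mem_iUnion, Set.mem_image, Prod.exists, Prod.map, id]
    constructor
    · intro hm
      exact ⟨k, x, z, hm, rfl⟩
    · rintro ⟨j, y, w, hm, he⟩
      rwa [he] at hm
  rw [hU]
  exact MeasurableSet.iUnion fun k =>
    ((measurableEmbedding_mkConfig k).prodMap MeasurableEmbedding.id).measurableSet_image.2 (h k hS)

/-- Sums over the points of a measurable random configuration are measurable, even when the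
summands also depend on the labels of the points and on further randomness. -/
lemma measurable_tsum_index {X Z : Type*} [MeasurableSpace X] [MeasurableSpace Z]
    {C : Z → Config X} (hC : Measurable C) {F : ℕ × ℕ → Z → X → ℝ≥0∞}
    (hF : ∀ a, Measurable (Function.uncurry (F a))) :
    Measurable fun z => ∑' p : (C z).Index, F ((C z).label p) z ((C z).point p) := by
  simp_rw [ENNReal.tsum_sigma', tsum_fintype]
  refine Measurable.tsum fun n => ?_
  have h : Measurable fun q : FiniteConfig X × Z => ∑ i : Fin q.1.1, F (n, i) q.2 (q.1.2 i) := by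
    refine measurable_finiteConfig_prod fun k => ?_
    change Measurable fun q : (Fin k → X) × Z => ∑ i : Fin k, F (n, i) q.2 (q.1 i)
    refine Finset.measurable_sum _ fun i _ => ?_
    exact (hF (n, i)).comp (measurable_snd.prodMk ((measurable_pi_apply i).comp measurable_fst))
  exact h.comp (((measurable_pi_apply n).comp hC).prodMk measurable_id)

lemma measurable_finiteConfig_sum {X : Type*} [MeasurableSpace X] {f : X → ℝ≥0∞}
    (hf : Measurable f) : Measurable fun s : FiniteConfig X => ∑ i, f (s.2 i) := by
  have : Measurable fun q : FiniteConfig X × Unit => ∑ i, f (q.1.2 i) := by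
    refine measurable_finiteConfig_prod fun k => ?_
    change Measurable fun q : (Fin k → X) × Unit => ∑ i : Fin k, f (q.1 i)
    exact Finset.measurable_sum _ fun i _ =>
      hf.comp ((measurable_pi_apply i).comp measurable_fst)
  exact this.comp (g := fun q : FiniteConfig X × Unit => ∑ i, f (q.1.2 i))
    (f := fun s => (s, ())) (measurable_id.prodMk measurable_const)

/-- The sum of a function over the points of a configuration. -/
def Config.sum {X : Type*} (c : Config X) (f : X → ℝ≥0∞) : ℝ≥0∞ := ∑' p : c.Index, f (c.point p)

lemma measurable_config_sum {X Z : Type*} [MeasurableSpace X] [MeasurableSpace Z]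
    {C : Z → Config X} (hC : Measurable C) {F : Z → X → ℝ≥0∞}
    (hF : Measurable (Function.uncurry F)) : Measurable fun z => (C z).sum (F z) :=
  measurable_tsum_index hC (F := fun _ => F) fun _ => hF

/-- Deletion of a point from a finite configuration; the empty configuration has no points. -/
def FiniteConfig.remove {X : Type*} : (s : FiniteConfig X) → Fin s.1 → FiniteConfig X
  | ⟨_ + 1, x⟩, i => ⟨_, fun j => x (i.succAbove j)⟩

/-- Deletion of a point from a configuration. The labels of other points may change. -/
def Config.remove {X : Type*} (c : Config X) (p : c.Index) : Config X :=
  Function.update c p.1 (FiniteConfig.remove (c p.1) p.2)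

lemma Config.remove_apply_self {X : Type*} (c : Config X) {n : ℕ} (i : Fin (c n).1) :
    c.remove ⟨n, i⟩ n = FiniteConfig.remove (c n) i :=
  Function.update_self (β := fun _ => FiniteConfig X) n _ c

lemma Config.remove_apply_of_ne {X : Type*} (c : Config X) {n m : ℕ} (i : Fin (c n).1)
    (h : m ≠ n) : c.remove ⟨n, i⟩ m = c m :=
  Function.update_of_ne (β := fun _ => FiniteConfig X) h _ c

lemma FiniteConfig.sum_remove {X : Type*} (s : FiniteConfig X) (i : Fin s.1) (f : X → ℝ≥0∞) :
    ∑ j, f (s.2 j) = f (s.2 i) + ∑ j, f ((FiniteConfig.remove s i).2 j) := by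
  obtain ⟨k, x⟩ := s
  cases k with
  | zero => exact i.elim0
  | succ k => exact Fin.sum_univ_succAbove _ i

lemma Config.sum_eq_tsum {X : Type*} (c : Config X) (f : X → ℝ≥0∞) :
    c.sum f = ∑' n, ∑ i, f ((c n).2 i) := by
  rw [Config.sum, ENNReal.tsum_sigma']
  simp_rw [tsum_fintype]
  rfl

lemma Config.sum_remove {X : Type*} (c : Config X) (p : c.Index) (f : X → ℝ≥0∞) :
    c.sum f = f (c.point p) + (c.remove p).sum f := by
  obtain ⟨n, i⟩ := p
  rw [Config.sum_eq_tsum, Config.sum_eq_tsum, ENNReal.tsum_eq_add_tsum_ite n,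
    ENNReal.tsum_eq_add_tsum_ite (f := fun m => ∑ j, f ((c.remove ⟨n, i⟩ m).2 j)) n,
    FiniteConfig.sum_remove (c n) i f, add_assoc]
  congr 2
  · rw [Config.remove_apply_self]
  · refine tsum_congr fun m => ?_
    split_ifs with h
    · rfl
    · rw [Config.remove_apply_of_ne c i h]

lemma Config.remove_sum_le {X : Type*} (c : Config X) (p : c.Index) (f : X → ℝ≥0∞) :
    (c.remove p).sum f ≤ c.sum f := by
  rw [c.sum_remove p f]; exact le_add_self

lemma Config.sum_mono {X : Type*} (c : Config X) {f g : X → ℝ≥0∞} (h : ∀ x, f x ≤ g x) :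
    c.sum f ≤ c.sum g :=
  ENNReal.tsum_le_tsum fun _ => h _

lemma Config.sum_add {X : Type*} (c : Config X) (f g : X → ℝ≥0∞) :
    c.sum (fun x => f x + g x) = c.sum f + c.sum g :=
  ENNReal.tsum_add

/-! ### The Mecke formula and the Laplace functional -/

lemma lintegral_finitePoissonLaw {X : Type*} [MeasurableSpace X] (ν : Measure X)
    [IsFiniteMeasure ν] {g : FiniteConfig X → ℝ≥0∞} (hg : Measurable g) :
    ∫⁻ s, g s ∂(finitePoissonLaw ν) =
      ∑' k : ℕ, ENNReal.ofReal (Real.exp (-ν.real Set.univ) / (k.factorial : ℝ)) *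
        ∫⁻ x, g ⟨k, x⟩ ∂(Measure.pi fun _ : Fin k => ν) := by
  rw [finitePoissonLaw, lintegral_sum_measure]
  refine tsum_congr fun k => ?_
  rw [lintegral_smul_measure, lintegral_map hg (measurable_mkConfig k), smul_eq_mul]

lemma measurable_sum_remove {X Z : Type*} [MeasurableSpace X] [MeasurableSpace Z]
    {F : X → FiniteConfig X → Z → ℝ≥0∞}
    (hF : Measurable fun q : X × FiniteConfig X × Z => F q.1 q.2.1 q.2.2) :
    Measurable fun q : FiniteConfig X × Z =>
      ∑ i : Fin q.1.1, F (q.1.2 i) (FiniteConfig.remove q.1 i) q.2 := by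
  refine measurable_finiteConfig_prod fun k => ?_
  change Measurable fun q : (Fin k → X) × Z =>
    ∑ i : Fin k, F (q.1 i) (FiniteConfig.remove ⟨k, q.1⟩ i) q.2
  refine Finset.measurable_sum _ fun i _ => ?_
  cases k with
  | zero => exact i.elim0
  | succ k =>
    refine hF.comp (f := fun q : (Fin (k + 1) → X) × Z =>
      (q.1 i, FiniteConfig.remove ⟨k + 1, q.1⟩ i, q.2))
      (((measurable_pi_apply i).comp measurable_fst).prodMk (Measurable.prodMk
        ((measurable_mkConfig k).comp (f := fun q : (Fin (k + 1) → X) × Z =>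
          fun j => q.1 (i.succAbove j)) ?_) measurable_snd))
    exact measurable_pi_lambda _ fun j => (measurable_pi_apply _).comp measurable_fst

/-- The Mecke formula for finite intensity. -/
lemma mecke_finitePoissonLaw {X : Type*} [MeasurableSpace X] (ν : Measure X) [IsFiniteMeasure ν]
    {F : X → FiniteConfig X → ℝ≥0∞} (hF : Measurable (Function.uncurry F)) :
    ∫⁻ s, ∑ i : Fin s.1, F (s.2 i) (FiniteConfig.remove s i) ∂(finitePoissonLaw ν) =
      ∫⁻ z, ∫⁻ s, F z s ∂(finitePoissonLaw ν) ∂ν := by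
  have hm : Measurable fun s : FiniteConfig X =>
      ∑ i : Fin s.1, F (s.2 i) (FiniteConfig.remove s i) :=
    (measurable_sum_remove (Z := Unit) (F := fun z s _ => F z s)
      (hF.comp (measurable_fst.prodMk (measurable_fst.comp measurable_snd)))).comp
      (f := fun s => (s, ())) (measurable_id.prodMk measurable_const)
  have hk (k : ℕ) : Measurable fun q : X × (Fin k → X) => F q.1 ⟨k, q.2⟩ :=
    hF.comp (measurable_fst.prodMk ((measurable_mkConfig k).comp measurable_snd))
  have hR : ∫⁻ z, ∫⁻ s, F z s ∂(finitePoissonLaw ν) ∂ν =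
      ∑' k : ℕ, ENNReal.ofReal (Real.exp (-ν.real Set.univ) / (k.factorial : ℝ)) *
        ∫⁻ z, ∫⁻ x, F z ⟨k, x⟩ ∂(Measure.pi fun _ : Fin k => ν) ∂ν := by
    have h (z : X) := lintegral_finitePoissonLaw ν (g := F z) (hF.comp measurable_prodMk_left)
    rw [lintegral_congr h,
      lintegral_tsum fun k => ((hk k).lintegral_prod_right'.const_mul _).aemeasurable]
    exact tsum_congr fun k => lintegral_const_mul _ (hk k).lintegral_prod_right'
  rw [hR, lintegral_finitePoissonLaw ν hm, tsum_eq_zero_add' ENNReal.summable]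
  have h0 (x : Fin 0 → X) : (∑ i : Fin (⟨0, x⟩ : FiniteConfig X).1,
      F ((⟨0, x⟩ : FiniteConfig X).2 i) (FiniteConfig.remove ⟨0, x⟩ i)) = 0 :=
    Finset.sum_eq_zero fun i _ => i.elim0
  have h0' : ∫⁻ x : Fin 0 → X, (∑ i : Fin (⟨0, x⟩ : FiniteConfig X).1,
      F ((⟨0, x⟩ : FiniteConfig X).2 i) (FiniteConfig.remove ⟨0, x⟩ i))
        ∂(Measure.pi fun _ : Fin 0 => ν) = 0 := by
    rw [lintegral_congr h0, lintegral_zero]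
  rw [h0', mul_zero, zero_add]
  refine tsum_congr fun k => ?_
  -- All `k + 1` points contribute equally, which turns `1 / (k + 1)!` into `1 / k!`.
  have hi (i : Fin (k + 1)) :
      ∫⁻ x, F (x i) ⟨k, fun j => x (i.succAbove j)⟩ ∂(Measure.pi fun _ : Fin (k + 1) => ν) =
        ∫⁻ z, ∫⁻ x, F z ⟨k, x⟩ ∂(Measure.pi fun _ : Fin k => ν) ∂ν := by
    rw [← lintegral_prod (fun q : X × (Fin k → X) => F q.1 ⟨k, q.2⟩) (hk k).aemeasurable]
    exact (measurePreserving_piFinSuccAbove (fun _ : Fin (k + 1) => ν) i).lintegral_comp (hk k)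
  have hsum : ∫⁻ x, ∑ i : Fin (k + 1), F (x i) (FiniteConfig.remove ⟨k + 1, x⟩ i)
      ∂(Measure.pi fun _ : Fin (k + 1) => ν) =
        (k + 1 : ℕ) * ∫⁻ z, ∫⁻ x, F z ⟨k, x⟩ ∂(Measure.pi fun _ : Fin k => ν) ∂ν := by
    rw [lintegral_finsetSum]
    · simp_rw [FiniteConfig.remove, hi]
      simp
    · intro i _
      refine (hk k).comp (f := fun x : Fin (k + 1) → X => (x i, fun j => x (i.succAbove j)))
        ((measurable_pi_apply i).prodMk ?_)
      exact measurable_pi_lambda _ fun j => measurable_pi_apply _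
  rw [hsum, ← mul_assoc, ← ENNReal.ofReal_natCast, ← ENNReal.ofReal_mul (by positivity)]
  congr 2
  rw [Nat.factorial_succ]
  push_cast
  field_simp

lemma lintegral_eq_tsum_sfiniteSeq {X : Type*} [MeasurableSpace X] (ν : Measure X) [SFinite ν]
    (g : X → ℝ≥0∞) : ∫⁻ z, g z ∂ν = ∑' n, ∫⁻ z, g z ∂(sfiniteSeq ν n) := by
  conv_lhs => rw [← sum_sfiniteSeq ν, lintegral_sum_measure]

/-- Resampling one coordinate preserves a product measure. -/
lemma measurePreserving_update {ι : Type*} [DecidableEq ι] {X : ι → Type*}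
    [∀ i, MeasurableSpace (X i)]
    (P : ∀ i, Measure (X i)) [∀ i, IsProbabilityMeasure (P i)] (n : ι) :
    MeasurePreserving (fun q : X n × (∀ i, X i) => Function.update q.2 n q.1)
      ((P n).prod (Measure.infinitePi P)) (Measure.infinitePi P) := by
  have hmeas : Measurable fun q : X n × (∀ i, X i) => Function.update q.2 n q.1 := by
    refine measurable_pi_lambda _ fun i => ?_
    rcases eq_or_ne i n with rfl | h
    · simpa using measurable_fst
    · simp only [Function.update_of_ne h]
      exact (measurable_pi_apply i).comp measurable_snd
  refine ⟨hmeas, Measure.eq_infinitePi _ fun s t ht => ?_⟩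
  rw [Measure.map_apply hmeas (MeasurableSet.pi s.countable_toSet fun i _ => ht i)]
  by_cases hn : n ∈ s
  · have : (fun q : X n × (∀ i, X i) => Function.update q.2 n q.1) ⁻¹' (Set.pi s t) =
        t n ×ˢ Set.pi (s.erase n : Finset ι) t := by
      ext ⟨x, y⟩
      simp only [Set.mem_preimage, Set.mem_pi, Set.mem_prod, Finset.mem_coe, Finset.mem_erase]
      constructor
      · refine fun h => ⟨by simpa using h n hn, fun i hi => ?_⟩
        simpa [Function.update_of_ne hi.1] using h i hi.2
      · rintro ⟨h1, h2⟩ i hi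
        rcases eq_or_ne i n with rfl | hne
        · simpa using h1
        · simpa [Function.update_of_ne hne] using h2 i ⟨hne, hi⟩
    rw [this, Measure.prod_prod, Measure.infinitePi_pi _ fun i _ => ht i,
      Finset.mul_prod_erase s (fun i => P i (t i)) hn]
  · have : (fun q : X n × (∀ i, X i) => Function.update q.2 n q.1) ⁻¹' (Set.pi s t) =
        Set.univ ×ˢ Set.pi s t := by
      ext ⟨x, y⟩
      simp only [Set.mem_preimage, Set.mem_pi, Set.mem_prod, Finset.mem_coe, Set.mem_univ,
        true_and]
      refine forall₂_congr fun i hi => ?_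
      rw [Function.update_of_ne (fun h : i = n => hn (h ▸ hi))]
    rw [this, Measure.prod_prod, Measure.infinitePi_pi _ fun i _ => ht i, measure_univ, one_mul]

lemma measurable_config_update {X : Type*} [MeasurableSpace X] (n : ℕ) :
    Measurable fun q : FiniteConfig X × Config X => Function.update q.2 n q.1 := by
  refine measurable_pi_lambda _ fun i => ?_
  rcases eq_or_ne i n with rfl | h
  · simpa using measurable_fst
  · simp only [Function.update_of_ne h]
    exact (measurable_pi_apply i).comp measurable_snd

lemma measurable_sum_update_remove {X : Type*} [MeasurableSpace X]
    {F : X → Config X → ℝ≥0∞} (hF : Measurable (Function.uncurry F)) (n : ℕ) :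
    Measurable fun q : FiniteConfig X × Config X =>
      ∑ i : Fin q.1.1, F (q.1.2 i) (Function.update q.2 n (FiniteConfig.remove q.1 i)) :=
  measurable_sum_remove (F := fun z s c => F z (Function.update c n s))
    (hF.comp (measurable_fst.prodMk ((measurable_config_update n).comp measurable_snd)))

lemma measurable_tsum_remove {X : Type*} [MeasurableSpace X]
    {F : X → Config X → ℝ≥0∞} (hF : Measurable (Function.uncurry F)) :
    Measurable fun c : Config X => ∑' p : c.Index, F (c.point p) (c.remove p) := by
  simp_rw [ENNReal.tsum_sigma', tsum_fintype]
  exact Measurable.tsum fun n => (measurable_sum_update_remove hF n).comp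
    (f := fun c : Config X => (c n, c)) ((measurable_pi_apply n).prodMk measurable_id)

/-- The Mecke formula: summing over the points of a Poisson process a function of the point and of
the remaining configuration amounts, in expectation, to integrating against the intensity with
the point chosen independently of the process. -/
theorem mecke_poissonLaw {X : Type*} [MeasurableSpace X] (ν : Measure X) [SFinite ν]
    {F : X → Config X → ℝ≥0∞} (hF : Measurable (Function.uncurry F)) :
    ∫⁻ c, ∑' p : c.Index, F (c.point p) (c.remove p) ∂(poissonLaw ν) =
      ∫⁻ z, ∫⁻ c, F z c ∂(poissonLaw ν) ∂ν := by
  classical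
  have hupd (n : ℕ) := measurable_config_update (X := X) n
  let G (n : ℕ) (q : FiniteConfig X × Config X) : ℝ≥0∞ :=
    ∑ i : Fin q.1.1, F (q.1.2 i) (Function.update q.2 n (FiniteConfig.remove q.1 i))
  have hG (n : ℕ) : Measurable (G n) := measurable_sum_update_remove hF n
  have hG' (n : ℕ) : Measurable fun c : Config X => G n (c n, c) :=
    (hG n).comp (f := fun c : Config X => (c n, c)) ((measurable_pi_apply n).prodMk measurable_id)
  have hn (n : ℕ) : ∫⁻ c : Config X, G n (c n, c) ∂(poissonLaw ν) =
        ∫⁻ z, ∫⁻ c, F z c ∂(poissonLaw ν) ∂(sfiniteSeq ν n) := by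
    have hmp := measurePreserving_update (fun n : ℕ => finitePoissonLaw (sfiniteSeq ν n)) n
    change MeasurePreserving _ ((finitePoissonLaw (sfiniteSeq ν n)).prod (poissonLaw ν))
      (poissonLaw ν) at hmp
    have key (q : FiniteConfig X × Config X) :
        G n (Function.update q.2 n q.1 n, Function.update q.2 n q.1) = G n q := by
      have : Function.update q.2 n q.1 n = q.1 := Function.update_self ..
      rw [this]
      simp only [G, Function.update_idem]
    have e1 := hmp.lintegral_comp (hG' n)
    rw [← e1, lintegral_congr key, lintegral_prod_symm' _ (hG n)]
    have e2 (c : Config X) : ∫⁻ s, G n (s, c) ∂(finitePoissonLaw (sfiniteSeq ν n)) = _ :=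
      mecke_finitePoissonLaw (sfiniteSeq ν n)
      (F := fun z s => F z (Function.update c n s))
      (hF.comp (measurable_fst.prodMk ((hupd n).comp (measurable_snd.prodMk measurable_const))))
    simp_rw [e2]
    have e3 : Measurable fun q : X × FiniteConfig X × Config X =>
        F q.1 (Function.update q.2.2 n q.2.1) :=
      hF.comp (measurable_fst.prodMk ((hupd n).comp measurable_snd))
    have e4 : Measurable fun q : Config X × X =>
        ∫⁻ s, F q.2 (Function.update q.1 n s) ∂(finitePoissonLaw (sfiniteSeq ν n)) := by
      refine Measurable.lintegral_prod_right
        (f := fun (q : Config X × X) s => F q.2 (Function.update q.1 n s)) ?_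
      exact e3.comp ((measurable_snd.comp measurable_fst).prodMk
        (measurable_snd.prodMk (measurable_fst.comp measurable_fst)))
    rw [lintegral_lintegral_swap e4.aemeasurable]
    refine lintegral_congr fun z => ?_
    have e5 : Measurable fun q : FiniteConfig X × Config X => F z (Function.update q.2 n q.1) :=
      e3.comp (measurable_const.prodMk measurable_id)
    rw [← lintegral_prod_symm' _ e5]
    exact hmp.lintegral_comp (hF.comp measurable_prodMk_left)
  simp_rw [ENNReal.tsum_sigma', tsum_fintype]
  change ∫⁻ c : Config X, ∑' n, G n (c n, c) ∂(poissonLaw ν) = _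
  rw [lintegral_tsum fun n => (hG' n).aemeasurable]
  rw [lintegral_eq_tsum_sfiniteSeq]
  exact tsum_congr hn

/-- Campbell's formula. -/
lemma lintegral_config_sum {X : Type*} [MeasurableSpace X] (ν : Measure X) [SFinite ν]
    {f : X → ℝ≥0∞} (hf : Measurable f) :
    ∫⁻ c, c.sum f ∂(poissonLaw ν) = ∫⁻ x, f x ∂ν := by
  have := mecke_poissonLaw ν (F := fun z _ => f z) (hf.comp measurable_fst)
  simpa [Config.sum] using this

lemma lintegral_pi_prod {X : Type*} [MeasurableSpace X] (ν : Measure X) [IsFiniteMeasure ν]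
    {g : X → ℝ≥0∞} (hg : Measurable g) (k : ℕ) :
    ∫⁻ x, ∏ i, g (x i) ∂(Measure.pi fun _ : Fin k => ν) = (∫⁻ x, g x ∂ν) ^ k := by
  induction k with
  | zero => simp
  | succ k ih =>
    have hm : Measurable fun x : Fin k → X => ∏ i, g (x i) :=
      Finset.measurable_prod _ fun i _ => hg.comp (measurable_pi_apply i)
    have := (measurePreserving_piFinSuccAbove (fun _ : Fin (k + 1) => ν) 0).lintegral_comp
      (f := fun q : X × (Fin k → X) => g q.1 * ∏ i, g (q.2 i))
      ((hg.comp measurable_fst).mul (hm.comp measurable_snd))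
    rw [lintegral_prod_mul hg.aemeasurable hm.aemeasurable, ih, ← pow_succ'] at this
    rw [← this]
    refine lintegral_congr fun x => ?_
    rw [Fin.prod_univ_succ]
    rfl

/-- Bound for the Laplace functional of a Poisson process with finite intensity. -/
lemma lintegral_expNeg_finitePoissonLaw_le {X : Type*} [MeasurableSpace X] (ν : Measure X)
    [IsFiniteMeasure ν] {f : X → ℝ≥0∞} (hf : Measurable f) (hf1 : ∀ x, f x ≤ 1) :
    ∫⁻ s : FiniteConfig X, expNeg (∑ i, f (s.2 i)) ∂(finitePoissonLaw ν) ≤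
      expNeg ((∫⁻ x, f x ∂ν) / 2) := by
  have hm : Measurable fun s : FiniteConfig X => expNeg (∑ i, f (s.2 i)) :=
     measurable_expNeg.comp (measurable_finiteConfig_sum hf)
  have hg : Measurable fun x => expNeg (f x) := measurable_expNeg.comp hf
  set m := ν.real Set.univ with hmdef
  have hm0 : 0 ≤ m := measureReal_nonneg
  have hνm : ν Set.univ = ENNReal.ofReal m := by simp [hmdef, Measure.real]
  have hle : ∫⁻ x, f x ∂ν ≤ ν Set.univ := by
    calc ∫⁻ x, f x ∂ν ≤ ∫⁻ _, 1 ∂ν := lintegral_mono hf1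
      _ = _ := by simp
  have hne : ∫⁻ x, f x ∂ν ≠ ∞ := ne_top_of_le_ne_top (measure_ne_top _ _) hle
  set b := (∫⁻ x, f x ∂ν).toReal with hb
  have hb0 : 0 ≤ b := ENNReal.toReal_nonneg
  have hbe : ∫⁻ x, f x ∂ν = ENNReal.ofReal b := (ENNReal.ofReal_toReal hne).symm
  have hbm : b ≤ m := by
    rw [hbe, hνm] at hle
    exact (ENNReal.ofReal_le_ofReal_iff hm0).1 hle
  have hgle : ∫⁻ x, expNeg (f x) ∂ν ≤ ENNReal.ofReal (m - b / 2) := by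
    have h1 : ∫⁻ x, expNeg (f x) ∂ν + (∫⁻ x, f x ∂ν) / 2 ≤ ν Set.univ := by
      rw [div_eq_mul_inv, ← lintegral_mul_const _ hf, ← lintegral_add_left hg]
      calc ∫⁻ x, expNeg (f x) + f x * 2⁻¹ ∂ν ≤ ∫⁻ _, 1 ∂ν :=
            lintegral_mono fun x => expNeg_add_half_le (hf1 x)
        _ = _ := by simp
    rw [hbe, hνm] at h1
    have h2 : ENNReal.ofReal b / 2 = ENNReal.ofReal (b / 2) := by
      rw [ENNReal.ofReal_div_of_pos (by norm_num)]; simp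
    rw [h2] at h1
    rw [ENNReal.ofReal_sub _ (by positivity)]
    exact ENNReal.le_sub_of_add_le_right (by simp) h1
  rw [lintegral_finitePoissonLaw ν hm]
  simp_rw [expNeg_sum, lintegral_pi_prod ν hg]
  have hs : HasSum (fun k : ℕ => Real.exp (-m) * ((m - b / 2) ^ k / (k.factorial : ℝ)))
      (Real.exp (-(b / 2))) := by
    have h := (NormedSpace.expSeries_div_hasSum_exp (m - b / 2)).mul_left (Real.exp (-m))
    rw [← Real.exp_eq_exp_ℝ, ← Real.exp_add] at h
    rwa [show -m + (m - b / 2) = -(b / 2) by ring] at h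
  have hmb : 0 ≤ m - b / 2 := by linarith
  calc ∑' k : ℕ, ENNReal.ofReal (Real.exp (-m) / (k.factorial : ℝ)) *
        (∫⁻ x, expNeg (f x) ∂ν) ^ k
      ≤ ∑' k : ℕ, ENNReal.ofReal (Real.exp (-m) * ((m - b / 2) ^ k / (k.factorial : ℝ))) := by
        refine ENNReal.tsum_le_tsum fun k => ?_
        refine (mul_le_mul_right (pow_le_pow_left' hgle k) _).trans (le_of_eq ?_)
        rw [← ENNReal.ofReal_pow hmb, ← ENNReal.ofReal_mul (by positivity)]
        congr 1
        ring
    _ = expNeg ((∫⁻ x, f x ∂ν) / 2) := by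
        rw [← ENNReal.ofReal_tsum_of_nonneg (fun k => by positivity) hs.summable, hs.tsum_eq, hbe]
        have h2 : ENNReal.ofReal b / 2 = ENNReal.ofReal (b / 2) := by
          rw [ENNReal.ofReal_div_of_pos (by norm_num)]; simp
        rw [h2, expNeg_ofReal (by positivity)]

/-- Bound for the Laplace functional of a Poisson process: `E exp (-∑ f) ≤ exp (-(∫ f) / 2)` for
`0 ≤ f ≤ 1`. -/
theorem lintegral_expNeg_config_sum_le {X : Type*} [MeasurableSpace X] (ν : Measure X) [SFinite ν]
    {f : X → ℝ≥0∞} (hf : Measurable f) (hf1 : ∀ x, f x ≤ 1) :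
    ∫⁻ c, expNeg (Config.sum c f) ∂(poissonLaw ν) ≤ expNeg ((∫⁻ x, f x ∂ν) / 2) := by
  have hm : Measurable fun s : FiniteConfig X => ∑ i, f (s.2 i) :=
     measurable_finiteConfig_sum hf
  have h := lintegral_expNeg_tsum_le (fun n : ℕ => finitePoissonLaw (sfiniteSeq ν n))
    (Y := fun _ s => ∑ i, f (s.2 i)) (fun _ => hm)
    (a := fun n => (∫⁻ x, f x ∂(sfiniteSeq ν n)) / 2)
    (fun n => lintegral_expNeg_finitePoissonLaw_le _ hf hf1)
  simp_rw [Config.sum_eq_tsum]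
  refine h.trans (le_of_eq ?_)
  rw [lintegral_eq_tsum_sfiniteSeq ν f]
  simp_rw [div_eq_mul_inv, ENNReal.tsum_mul_right]

/-! ### The deterministic conditions -/

namespace Data

variable {Ω : Type*} [MeasurableSpace Ω]

lemma measurable_coe_W (𝕎 : Data Ω) :
    Measurable fun q : Ω × Ω => (𝕎.W q.1 q.2 : ℝ≥0∞) := 𝕎.measurable_W.coe_nnreal_ennreal

lemma measurable_coe_S (𝕎 : Data Ω) : Measurable fun x => (𝕎.S x : ℝ≥0∞) :=
  𝕎.measurable_S.coe_nnreal_ennreal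

lemma coe_W_le_one (𝕎 : Data Ω) (x y : Ω) : (𝕎.W x y : ℝ≥0∞) ≤ 1 := by
  exact_mod_cast 𝕎.W_le_one x y

lemma measurable_degW (𝕎 : Data Ω) (μ : Measure Ω) [SFinite μ] : Measurable (𝕎.degW μ) :=
  𝕎.measurable_coe_W.lintegral_prod_right'

lemma measurable_deg (𝕎 : Data Ω) (μ : Measure Ω) [SFinite μ] : Measurable (𝕎.deg μ) :=
  (𝕎.measurable_degW μ).add 𝕎.measurable_coe_S

/-- The mass `∫∫ W` of the graphon part on `A × B`. -/
def massW (𝕎 : Data Ω) (μ : Measure Ω) (A B : Set Ω) : ℝ≥0∞ :=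
  ∫⁻ x in A, ∫⁻ y in B, (𝕎.W x y : ℝ≥0∞) ∂μ ∂μ

variable (𝕎 : Data Ω) (μ : Measure Ω)

lemma measurable_lintegral_W [SigmaFinite μ] (B : Set Ω) :
    Measurable fun x => ∫⁻ y in B, (𝕎.W x y : ℝ≥0∞) ∂μ :=
  𝕎.measurable_coe_W.lintegral_prod_right'

lemma massW_comm [SigmaFinite μ] (A B : Set Ω) : 𝕎.massW μ A B = 𝕎.massW μ B A := by
  rw [massW, massW, lintegral_lintegral_swap 𝕎.measurable_coe_W.aemeasurable]
  simp_rw [𝕎.symm_W]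

lemma massW_mono {A B A' B' : Set Ω} (hA : A ⊆ A') (hB : B ⊆ B') :
    𝕎.massW μ A B ≤ 𝕎.massW μ A' B' :=
  (lintegral_mono_set hA).trans (lintegral_mono fun _ => lintegral_mono_set hB)

lemma massW_union_left_le (A A' B : Set Ω) :
    𝕎.massW μ (A ∪ A') B ≤ 𝕎.massW μ A B + 𝕎.massW μ A' B :=
  lintegral_union_le _ A A'

lemma massW_union_right_le [SigmaFinite μ] (A B B' : Set Ω) :
    𝕎.massW μ A (B ∪ B') ≤ 𝕎.massW μ A B + 𝕎.massW μ A B' := by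
  rw [massW_comm, massW_comm 𝕎 μ A B, massW_comm 𝕎 μ A B']
  exact massW_union_left_le ..

lemma massW_le_of_degW_le {A : Set Ω} (B : Set Ω) {D : ℝ≥0∞}
    (h : ∀ x ∈ A, 𝕎.degW μ x ≤ D) : 𝕎.massW μ A B ≤ D * μ A := by
  calc 𝕎.massW μ A B ≤ ∫⁻ _ in A, D ∂μ :=
        setLIntegral_mono measurable_const fun x hx =>
          (setLIntegral_le_lintegral _ _).trans (h x hx)
    _ = D * μ A := by simp

lemma lintegral_restrict_W [SigmaFinite μ] {A : Set Ω} (hA : MeasurableSet A) :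
    ∫⁻ p : A × A, (𝕎.W p.1 p.2 : ℝ≥0∞)
      ∂((μ.comap ((↑) : A → Ω)).prod (μ.comap ((↑) : A → Ω))) = 𝕎.massW μ A A := by
  have : SigmaFinite (μ.comap ((↑) : A → Ω)) :=
    .of_map _ measurable_subtype_coe.aemeasurable <| by
      rw [(MeasurableEmbedding.subtype_coe hA).map_comap]
      infer_instance
  have hm : Measurable fun p : A × A => (𝕎.W p.1 p.2 : ℝ≥0∞) :=
    𝕎.measurable_coe_W.comp ((measurable_subtype_coe.comp measurable_fst).prodMk
      (measurable_subtype_coe.comp measurable_snd))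
  rw [lintegral_prod _ hm.aemeasurable]
  have h (x : A) := lintegral_subtype_comap (μ := μ) hA fun y => (𝕎.W x y : ℝ≥0∞)
  rw [lintegral_congr h]
  exact lintegral_subtype_comap hA fun x => ∫⁻ y in A, (𝕎.W x y : ℝ≥0∞) ∂μ

lemma isIntegrable_restrict_iff [SigmaFinite μ] {A : Set Ω} (hA : MeasurableSet A) :
    (𝕎.restrict A).IsIntegrable (μ.comap (↑)) ↔
      𝕎.massW μ A A < ∞ ∧ ∫⁻ x in A, (𝕎.S x : ℝ≥0∞) ∂μ < ∞ := by
  have h1 := 𝕎.lintegral_restrict_W μ hA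
  have h2 := lintegral_subtype_comap (μ := μ) hA fun x => (𝕎.S x : ℝ≥0∞)
  rw [IsIntegrable, norm1]
  simp only [restrict]
  rw [h1, h2]
  simp only [ENNReal.add_lt_top, ENNReal.mul_lt_top_iff, ENNReal.ofNat_lt_top,
    ENNReal.coe_lt_top, true_and, and_true, true_or]
  refine and_congr_right fun _ => ⟨?_, .inl⟩
  rintro (h | h | h)
  · exact h
  · norm_num at h
  · simp [h]

lemma graphonIntegrable_restrict_iff [SigmaFinite μ] {A : Set Ω} (hA : MeasurableSet A) :
    (𝕎.restrict A).GraphonIntegrable (μ.comap (↑)) ↔ 𝕎.massW μ A A < ∞ := by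
  rw [GraphonIntegrable, ← 𝕎.lintegral_restrict_W μ hA, Integrable, and_iff_right]
  · rw [hasFiniteIntegral_iff_enorm]
    simp [restrict, enorm_eq_nnnorm]
  · exact (𝕎.restrict A).measurable_W.coe_nnreal_real.aestronglyMeasurable

lemma integrable_min_S_iff :
    Integrable (fun x => min (𝕎.S x : ℝ) 1) μ ↔ ∫⁻ x, min (𝕎.S x : ℝ≥0∞) 1 ∂μ < ∞ := by
  rw [Integrable, and_iff_right]
  · rw [hasFiniteIntegral_iff_enorm]
    have (x : Ω) : ‖min (𝕎.S x : ℝ) 1‖ₑ = min (𝕎.S x : ℝ≥0∞) 1 := by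
      rw [show min (𝕎.S x : ℝ) 1 = ((min (𝕎.S x) 1 : ℝ≥0) : ℝ) by push_cast; rfl,
        Real.enorm_eq_ofReal (NNReal.coe_nonneg _), ENNReal.ofReal_coe_nnreal]
      push_cast
      rfl
    simp_rw [this]
  · exact (𝕎.measurable_S.coe_nnreal_real.min measurable_const).aestronglyMeasurable

lemma locallyFinite₁_iff : 𝕎.LocallyFinite₁ μ ↔ ∀ᵐ x ∂μ, 𝕎.degW μ x < ∞ := by
  refine Filter.eventually_congr (.of_forall fun x => ?_)
  rw [Integrable, and_iff_right]
  · rw [hasFiniteIntegral_iff_enorm, degW]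
    simp [enorm_eq_nnnorm, 𝕎.symm_W x]
  · exact (𝕎.measurable_W.comp measurable_prodMk_right).coe_nnreal_real.aestronglyMeasurable

lemma locallyFinite₂_iff [SigmaFinite μ] : 𝕎.LocallyFinite₂ μ ↔
    ∃ A : Set Ω, MeasurableSet A ∧ μ Aᶜ < ∞ ∧ 𝕎.massW μ A A < ∞ ∧ ∫⁻ x in A, (𝕎.S x : ℝ≥0∞) ∂μ < ∞ := by
  refine exists_congr fun A => and_congr_right fun hA => and_congr_right fun _ => ?_
  exact 𝕎.isIntegrable_restrict_iff μ hA

variable {𝕎 μ}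

lemma measure_lt_top_of_lintegral {f : Ω → ℝ≥0∞} (hf : Measurable f) {A : Set Ω}
    (hA : MeasurableSet A)
    (h : ∫⁻ x in A, f x ∂μ < ∞) {ε : ℝ≥0∞} (hε : ε ≠ 0) (hε' : ε ≠ ∞) :
    μ (A ∩ {x | ε ≤ f x}) < ∞ := by
  have := meas_ge_le_lintegral_div (μ := μ.restrict A) hf.aemeasurable hε hε'
  rw [Measure.restrict_apply' hA, Set.inter_comm] at this
  exact this.trans_lt (ENNReal.div_lt_top h.ne hε)

/-- The degrees into a set of finite measure may be large everywhere, but only because of the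
vertices of large degree in it: after discarding a part of measure less than `D / 2`, the set has
bounded degrees, so it contributes an integrable amount to the degrees of the other vertices. -/
lemma measure_degW_gt_lt_top [SigmaFinite μ] (h₁ : ∀ᵐ x ∂μ, 𝕎.degW μ x < ∞)
    {A : Set Ω} (hA : MeasurableSet A) (hAc : μ Aᶜ < ∞) (hW : 𝕎.massW μ A A < ∞) {D : ℝ≥0} (hD : 0 < D) :
    μ {x | (D : ℝ≥0∞) < 𝕎.degW μ x} < ∞ := by
  have hd := 𝕎.measurable_degW μ
  -- the part of `Aᶜ` with degrees larger than `k` has small measure for large `k`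
  obtain ⟨k, hk⟩ : ∃ k : ℕ, μ (Aᶜ ∩ {x | (k : ℝ≥0∞) < 𝕎.degW μ x}) < (D / 2 : ℝ≥0) := by
    have : IsFiniteMeasure (μ.restrict Aᶜ) := ⟨by rwa [Measure.restrict_apply_univ]⟩
    obtain ⟨k, hk⟩ := exists_nat_measure_gt_lt (μ.restrict Aᶜ) hd (ae_restrict_of_ae h₁)
      (ε := (D / 2 : ℝ≥0)) (by simpa using hD.ne')
    rw [Measure.restrict_apply' hA.compl, Set.inter_comm] at hk
    exact ⟨k, hk⟩
  set B := Aᶜ ∩ {x | 𝕎.degW μ x ≤ k} with hB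
  have hBm : MeasurableSet B := hA.compl.inter (measurableSet_le hd measurable_const)
  have hint : ∫⁻ x in A, ∫⁻ y in A ∪ B, (𝕎.W x y : ℝ≥0∞) ∂μ ∂μ < ∞ := by
    refine (𝕎.massW_union_right_le μ A A B).trans_lt (ENNReal.add_lt_top.2 ⟨hW, ?_⟩)
    rw [massW_comm]
    refine (𝕎.massW_le_of_degW_le μ A fun x hx => hx.2).trans_lt ?_
    exact ENNReal.mul_lt_top (by simp) ((measure_mono Set.inter_subset_left).trans_lt hAc)
  have hfin := measure_lt_top_of_lintegral (𝕎.measurable_lintegral_W μ (A ∪ B)) hA hint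
    (ε := (D / 2 : ℝ≥0)) (by simpa using hD.ne') ENNReal.coe_ne_top
  refine (measure_mono (t := Aᶜ ∪ (A ∩ {x | ((D / 2 : ℝ≥0) : ℝ≥0∞) ≤
    ∫⁻ y in A ∪ B, (𝕎.W x y : ℝ≥0∞) ∂μ})) fun x hx => ?_).trans_lt
    ((measure_union_le _ _).trans_lt (ENNReal.add_lt_top.2 ⟨hAc, hfin⟩))
  by_cases hxA : x ∈ A
  · refine Or.inr ⟨hxA, ?_⟩
    by_contra hlt
    rw [Set.mem_ofPred_eq, not_le] at hlt
    have huniv : (A ∪ B) ∪ (Aᶜ ∩ {x | (k : ℝ≥0∞) < 𝕎.degW μ x}) = Set.univ := by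
      refine Set.eq_univ_of_forall fun y => ?_
      by_cases hy : y ∈ A
      · exact .inl (.inl hy)
      · rcases le_or_gt (𝕎.degW μ y) k with h | h
        · exact .inl (.inr ⟨hy, h⟩)
        · exact .inr ⟨hy, h⟩
    have hsum : 𝕎.degW μ x ≤ ∫⁻ y in A ∪ B, (𝕎.W x y : ℝ≥0∞) ∂μ +
        μ (Aᶜ ∩ {x | (k : ℝ≥0∞) < 𝕎.degW μ x}) := by
      rw [degW, ← setLIntegral_univ, ← huniv]
      refine (lintegral_union_le _ _ _).trans (add_le_add le_rfl ?_)
      calc ∫⁻ y in Aᶜ ∩ {x | (k : ℝ≥0∞) < 𝕎.degW μ x}, (𝕎.W x y : ℝ≥0∞) ∂μ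
          ≤ ∫⁻ _ in Aᶜ ∩ {x | (k : ℝ≥0∞) < 𝕎.degW μ x}, 1 ∂μ :=
            lintegral_mono fun y => 𝕎.coe_W_le_one x y
        _ = _ := by simp
    have : 𝕎.degW μ x < D := by
      refine hsum.trans_lt ((ENNReal.add_lt_add hlt hk).trans_le (le_of_eq ?_))
      rw [← ENNReal.coe_add, add_halves]
    exact absurd hx (not_lt.2 this.le)
  · exact .inl hxA

lemma massW_degW_le_lt_top [SigmaFinite μ] {A : Set Ω}
    (hAc : μ Aᶜ < ∞) (hW : 𝕎.massW μ A A < ∞) (D : ℝ≥0) :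
    𝕎.massW μ {x | 𝕎.degW μ x ≤ D} {x | 𝕎.degW μ x ≤ D} < ∞ := by
  set E := {x | 𝕎.degW μ x ≤ D} with hE
  have hEm : MeasurableSet E := measurableSet_le (𝕎.measurable_degW μ) measurable_const
  have hsub : E ⊆ A ∪ (Aᶜ ∩ E) := fun x hx => by
    by_cases h : x ∈ A
    · exact .inl h
    · exact .inr ⟨h, hx⟩
  have hb (B : Set Ω) : 𝕎.massW μ (Aᶜ ∩ E) B < ∞ :=
    (𝕎.massW_le_of_degW_le μ B fun x hx => hx.2).trans_lt
      (ENNReal.mul_lt_top (by simp) ((measure_mono Set.inter_subset_left).trans_lt hAc))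
  refine (𝕎.massW_mono μ hsub hsub).trans_lt ((𝕎.massW_union_left_le μ _ _ _).trans_lt ?_)
  refine ENNReal.add_lt_top.2 ⟨(𝕎.massW_union_right_le μ _ _ _).trans_lt ?_, hb _⟩
  refine ENNReal.add_lt_top.2 ⟨hW, ?_⟩
  rw [massW_comm]
  exact hb _

lemma lintegral_min_S_lt_top {A : Set Ω} (hA : MeasurableSet A) (hAc : μ Aᶜ < ∞)
    (hS : ∫⁻ x in A, (𝕎.S x : ℝ≥0∞) ∂μ < ∞) : ∫⁻ x, min (𝕎.S x : ℝ≥0∞) 1 ∂μ < ∞ := by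
  rw [← lintegral_add_compl _ hA]
  refine ENNReal.add_lt_top.2 ⟨(lintegral_mono fun x => min_le_left _ _).trans_lt hS, ?_⟩
  refine (lintegral_mono fun x => min_le_right _ _).trans_lt ?_
  simpa using hAc

lemma measure_S_gt_lt_top (hS : ∫⁻ x, min (𝕎.S x : ℝ≥0∞) 1 ∂μ < ∞) {D : ℝ≥0} (hD : 0 < D) :
    μ {x | (D : ℝ≥0∞) < 𝕎.S x} < ∞ := by
  rw [← setLIntegral_univ] at hS
  have := measure_lt_top_of_lintegral (𝕎.measurable_coe_S.min measurable_const) .univ hS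
    (ε := (min D 1 : ℝ≥0)) (by simpa using hD.ne') (by simp)
  refine (measure_mono fun x hx => ?_).trans_lt this
  refine ⟨trivial, ?_⟩
  simp only [Set.mem_ofPred_eq, ENNReal.coe_min, ENNReal.coe_one]
  exact min_le_min_right _ (le_of_lt hx)

lemma lintegral_S_lt_top (hS : ∫⁻ x, min (𝕎.S x : ℝ≥0∞) 1 ∂μ < ∞) {A : Set Ω}
    {D : ℝ≥0} (hD : ∀ x ∈ A, (𝕎.S x : ℝ≥0∞) ≤ D) : ∫⁻ x in A, (𝕎.S x : ℝ≥0∞) ∂μ < ∞ := by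
  have hm : Measurable fun x => min (𝕎.S x : ℝ≥0∞) 1 := 𝕎.measurable_coe_S.min measurable_const
  calc ∫⁻ x in A, (𝕎.S x : ℝ≥0∞) ∂μ ≤ ∫⁻ x in A, max (D : ℝ≥0∞) 1 * min (𝕎.S x : ℝ≥0∞) 1 ∂μ := by
        refine setLIntegral_mono (hm.const_mul _) fun x hx => ?_
        rcases le_total (𝕎.S x : ℝ≥0∞) 1 with h | h
        · rw [min_eq_left h]
          exact le_mul_of_one_le_left' (le_max_right _ _)
        · rw [min_eq_right h, mul_one]
          exact (hD x hx).trans (le_max_left _ _)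
    _ = max (D : ℝ≥0∞) 1 * ∫⁻ x in A, min (𝕎.S x : ℝ≥0∞) 1 ∂μ := lintegral_const_mul _ hm
    _ < ∞ := ENNReal.mul_lt_top (by simp) ((setLIntegral_le_lintegral _ _).trans_lt hS)

/-- The set where degree and star intensity are bounded is a witness for condition (2). -/
lemma locallyFinite₂_of_degW [SigmaFinite μ] (hS : ∫⁻ x, min (𝕎.S x : ℝ≥0∞) 1 ∂μ < ∞) {D : ℝ≥0}
    (hμ : μ {x | (D : ℝ≥0∞) < 𝕎.degW μ x} < ∞)
    (hW : 𝕎.massW μ {x | 𝕎.degW μ x ≤ D} {x | 𝕎.degW μ x ≤ D} < ∞) : 𝕎.LocallyFinite₂ μ := by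
  rw [locallyFinite₂_iff]
  have h1 : MeasurableSet {x | 𝕎.degW μ x ≤ D} :=
    measurableSet_le (𝕎.measurable_degW μ) measurable_const
  have h2 : MeasurableSet {x | (𝕎.S x : ℝ≥0∞) ≤ (1 : ℝ≥0)} :=
    measurableSet_le 𝕎.measurable_coe_S measurable_const
  refine ⟨{x | 𝕎.degW μ x ≤ D} ∩ {x | (𝕎.S x : ℝ≥0∞) ≤ (1 : ℝ≥0)}, h1.inter h2, ?_, ?_, ?_⟩
  · rw [Set.compl_inter]
    refine (measure_union_le _ _).trans_lt (ENNReal.add_lt_top.2 ⟨?_, ?_⟩)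
    · simpa [Set.compl_ofPred] using hμ
    · simpa [Set.compl_ofPred] using measure_S_gt_lt_top hS one_pos
  · exact (𝕎.massW_mono μ Set.inter_subset_left Set.inter_subset_left).trans_lt hW
  · exact lintegral_S_lt_top hS fun x hx => hx.2

theorem tfae_locallyFinite₂ [SigmaFinite μ] (h₁ : 𝕎.LocallyFinite₁ μ) :
      List.TFAE [
        𝕎.LocallyFinite₂ μ,
        ∀ D : ℝ≥0, 0 < D →
          μ {x | (D : ℝ≥0∞) < 𝕎.deg μ x} < ∞ ∧
          (𝕎.restrict {x | 𝕎.deg μ x ≤ D}).IsIntegrable (μ.comap (↑)),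
        ∃ D : ℝ≥0, 0 < D ∧
          μ {x | (D : ℝ≥0∞) < 𝕎.deg μ x} < ∞ ∧
          (𝕎.restrict {x | 𝕎.deg μ x ≤ D}).IsIntegrable (μ.comap (↑)),
        ∀ D : ℝ≥0, 0 < D →
          μ {x | (D : ℝ≥0∞) < 𝕎.degW μ x} < ∞ ∧
          (𝕎.restrict {x | 𝕎.degW μ x ≤ D}).GraphonIntegrable (μ.comap (↑)) ∧
          Integrable (fun x => min (𝕎.S x : ℝ) 1) μ,
        ∃ D : ℝ≥0, 0 < D ∧
          μ {x | (D : ℝ≥0∞) < 𝕎.degW μ x} < ∞ ∧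
          (𝕎.restrict {x | 𝕎.degW μ x ≤ D}).GraphonIntegrable (μ.comap (↑)) ∧
          Integrable (fun x => min (𝕎.S x : ℝ) 1) μ] := by
  rw [locallyFinite₁_iff] at h₁
  have hdW (D : ℝ≥0) : MeasurableSet {x | 𝕎.degW μ x ≤ D} :=
    measurableSet_le (𝕎.measurable_degW μ) measurable_const
  have hd (D : ℝ≥0) : MeasurableSet {x | 𝕎.deg μ x ≤ D} :=
    measurableSet_le (𝕎.measurable_deg μ) measurable_const
  simp only [graphonIntegrable_restrict_iff 𝕎 μ (hdW _), isIntegrable_restrict_iff 𝕎 μ (hd _),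
    integrable_min_S_iff]
  tfae_have 1 → 4 := fun h D hD => by
    obtain ⟨A, hA, hAc, hW, hS⟩ := (𝕎.locallyFinite₂_iff μ).1 h
    exact ⟨measure_degW_gt_lt_top h₁ hA hAc hW hD, massW_degW_le_lt_top hAc hW D,
      lintegral_min_S_lt_top hA hAc hS⟩
  tfae_have 4 → 5 := fun h => ⟨1, one_pos, h 1 one_pos⟩
  tfae_have 5 → 1 := fun ⟨D, _, hμ, hW, hS⟩ => locallyFinite₂_of_degW hS hμ hW
  tfae_have 4 → 2 := fun h D hD => by
    have hD2 : 0 < D / 2 := by positivity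
    refine ⟨?_, ?_, ?_⟩
    · refine (measure_mono (t := {x | ((D / 2 : ℝ≥0) : ℝ≥0∞) < 𝕎.degW μ x} ∪
        {x | ((D / 2 : ℝ≥0) : ℝ≥0∞) < 𝕎.S x}) fun x hx => ?_).trans_lt
        ((measure_union_le _ _).trans_lt (ENNReal.add_lt_top.2
          ⟨(h _ hD2).1, measure_S_gt_lt_top (h _ hD2).2.2 hD2⟩))
      by_contra hn
      simp only [Set.mem_union, Set.mem_ofPred_eq, not_or, not_lt] at hn
      refine absurd hx (not_lt.2 ((add_le_add hn.1 hn.2).trans (le_of_eq ?_)))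
      rw [← ENNReal.coe_add, add_halves]
    · have hsub : {x | 𝕎.deg μ x ≤ D} ⊆ {x | 𝕎.degW μ x ≤ D} := fun x hx =>
        (le_self_add (a := 𝕎.degW μ x)).trans (show 𝕎.deg μ x ≤ D from hx)
      exact (𝕎.massW_mono μ hsub hsub).trans_lt (h D hD).2.1
    · exact lintegral_S_lt_top (h D hD).2.2 fun x hx =>
        (le_add_self (a := (𝕎.S x : ℝ≥0∞))).trans (show 𝕎.deg μ x ≤ D from hx)
  tfae_have 2 → 3 := fun h => ⟨1, one_pos, h 1 one_pos⟩
  tfae_have 3 → 1 := fun ⟨D, _, hμ, hW, hS⟩ => by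
    rw [locallyFinite₂_iff]
    refine ⟨_, hd D, ?_, hW, hS⟩
    simpa [Set.compl_ofPred] using hμ
  tfae_finish

end Data

/-! ### Lebesgue measure, uniform coins and points in sets of finite intensity -/

lemma lebesgue_apply (A : Set ℝ≥0) : lebesgue A = volume (((↑) : ℝ≥0 → ℝ) '' A) :=
  (MeasurableEmbedding.subtype_coe measurableSet_Ici).comap_apply _ _

lemma lebesgue_Iio (s : ℝ≥0) : lebesgue (Set.Iio s) = s := by
  have : ((↑) : ℝ≥0 → ℝ) '' Set.Iio s = Set.Ico 0 (s : ℝ) := by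
    ext x
    constructor
    · rintro ⟨y, hy, rfl⟩
      exact ⟨y.2, NNReal.coe_lt_coe.2 hy⟩
    · rintro ⟨h0, h1⟩
      exact ⟨⟨x, h0⟩, NNReal.coe_lt_coe.1 h1, rfl⟩
  rw [lebesgue_apply, this, Real.volume_Ico, sub_zero, ENNReal.ofReal_coe_nnreal]

lemma lebesgue_singleton (s : ℝ≥0) : lebesgue {s} = 0 := by
  rw [lebesgue_apply, Set.image_singleton, Real.volume_singleton]

lemma lebesgue_Iic (s : ℝ≥0) : lebesgue (Set.Iic s) = s := by
  rw [← lebesgue_Iio, ← Set.Iic_sdiff_right, measure_sdiff_null (lebesgue_singleton s)]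

lemma lebesgue_Ioc (s t : ℝ≥0) (h : s ≤ t) : lebesgue (Set.Ioc s t) = (t - s : ℝ≥0) := by
  rw [← Set.Iic_sdiff_Iic, measure_sdiff (Set.Iic_subset_Iic.2 h)
    measurableSet_Iic.nullMeasurableSet (by simp [lebesgue_Iic]), lebesgue_Iic, lebesgue_Iic,
    ENNReal.coe_sub]

lemma volume_coin_lt {w : ℝ≥0} (hw : w ≤ 1) :
    (volume : Measure unitInterval) {u | (u : ℝ) < w} = w := by
  have : ((↑) : unitInterval → ℝ) '' {u | (u : ℝ) < w} = Set.Ico 0 (w : ℝ) := by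
    ext x
    constructor
    · rintro ⟨y, hy, rfl⟩
      exact ⟨y.2.1, hy⟩
    · rintro ⟨h0, h1⟩
      exact ⟨⟨x, h0, h1.le.trans (by exact_mod_cast hw)⟩, h1, rfl⟩
  rw [show (volume : Measure unitInterval) = Measure.comap (↑) (volume : Measure ℝ) from rfl,
    (MeasurableEmbedding.subtype_coe measurableSet_Icc).comap_apply, this, Real.volume_Ico,
    sub_zero, ENNReal.ofReal_coe_nnreal]

lemma Config.label_injective {X : Type*} (c : Config X) : Function.Injective c.label := by
  rintro ⟨n, i⟩ ⟨m, j⟩ h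
  obtain ⟨rfl, h2⟩ := Prod.mk.inj h
  exact congrArg _ (Fin.ext h2)

lemma lintegral_indicator_one_prodMk {X Y : Type*} [MeasurableSpace X] [MeasurableSpace Y]
    (P : Measure Y) {V : Set (X × Y)} (hV : MeasurableSet V) (x : X) :
    ∫⁻ y, V.indicator 1 (x, y) ∂P = P (Prod.mk x ⁻¹' V) :=
  lintegral_indicator_one (measurable_prodMk_left hV)

lemma finite_of_tsum_ne_top {ι : Type*} {f : ι → ℝ≥0∞} (h : ∑' i, f i ≠ ∞) {s : Set ι}
    (hs : ∀ i ∈ s, f i = 1) : s.Finite :=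
  (ENNReal.finite_const_le_of_tsum_ne_top h one_ne_zero).subset fun i hi => (hs i hi).ge

lemma ae_config_sum_lt_top {X : Type*} [MeasurableSpace X] (ν : Measure X) [SFinite ν]
    {f : X → ℝ≥0∞} (hf : Measurable f) (h : ∫⁻ x, f x ∂ν < ∞) :
    ∀ᵐ c ∂(poissonLaw ν), Config.sum c f < ∞ := by
  refine ae_lt_top (measurable_config_sum measurable_id (F := fun _ => f)
    (hf.comp measurable_snd)) ?_
  exact ((lintegral_config_sum ν hf).trans_lt h).ne

lemma ae_finite_points {X : Type*} [MeasurableSpace X] (ν : Measure X) [SFinite ν] {A : Set X}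
    (hA : MeasurableSet A) (h : ν A < ∞) :
    ∀ᵐ c ∂(poissonLaw ν), {p : Config.Index c | c.point p ∈ A}.Finite := by
  filter_upwards [ae_config_sum_lt_top ν (measurable_one.indicator hA)
    (by rwa [lintegral_indicator_one hA])] with c hc
  refine finite_of_tsum_ne_top hc.ne fun p hp => ?_
  exact Set.indicator_of_mem (show c.point p ∈ A from hp) 1

lemma ae_forall_points {X : Type*} [MeasurableSpace X] (ν : Measure X) [SFinite ν] {q : X → Prop}
    (h : ∀ᵐ x ∂ν, q x) : ∀ᵐ c ∂(poissonLaw ν), ∀ p : Config.Index c, q (c.point p) := by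
  obtain ⟨N, hN, hNm, hN0⟩ := exists_measurable_superset_of_null (ae_iff.1 h)
  have hm : Measurable (N.indicator (1 : X → ℝ≥0∞)) := measurable_one.indicator hNm
  have h0 : ∫⁻ c, Config.sum c (N.indicator 1) ∂(poissonLaw ν) = 0 := by
    rw [lintegral_config_sum ν hm, lintegral_indicator_one hNm, hN0]
  have h0' := (lintegral_eq_zero_iff (measurable_config_sum measurable_id
    (F := fun _ => N.indicator 1) (hm.comp measurable_snd))).1 h0
  filter_upwards [h0'] with c hc p
  by_contra hq
  have : N.indicator (1 : X → ℝ≥0∞) (c.point p) = 0 := ENNReal.tsum_eq_zero.1 hc p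
  rw [Set.indicator_of_mem (hN hq)] at this
  exact one_ne_zero this

lemma lintegral_config_sum_sum {X : Type*} [MeasurableSpace X] (ν : Measure X) [SFinite ν]
    {w : X → X → ℝ≥0∞} (hw : Measurable (Function.uncurry w)) (h0 : ∀ x, w x x = 0) :
    ∫⁻ c, Config.sum c (fun x => c.sum (w x)) ∂(poissonLaw ν) = ∫⁻ x, ∫⁻ y, w x y ∂ν ∂ν := by
  have hF : Measurable (Function.uncurry fun (x : X) (c : Config X) => c.sum (w x)) :=
    measurable_config_sum (C := fun q : X × Config X => q.2) measurable_snd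
      (F := fun q => w q.1) (hw.comp ((measurable_fst.comp measurable_fst).prodMk measurable_snd))
  calc ∫⁻ c, Config.sum c (fun x => c.sum (w x)) ∂(poissonLaw ν)
      = ∫⁻ c, ∑' p : Config.Index c, (c.remove p).sum (w (c.point p)) ∂(poissonLaw ν) := by
        refine lintegral_congr fun c => tsum_congr fun p => ?_
        change c.sum (w (c.point p)) = _
        rw [c.sum_remove p, h0, zero_add]
    _ = ∫⁻ x, ∫⁻ y, w x y ∂ν ∂ν := by
        rw [mecke_poissonLaw ν hF]
        exact lintegral_congr fun x => lintegral_config_sum ν (hw.comp measurable_prodMk_left)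

lemma locallyFinite_adjacencyMeasure_iff (G : SimpleGraph ℝ≥0) :
    LocallyFiniteMeasure (adjacencyMeasure G) ↔
      ∀ n : ℕ, {e : ℝ≥0 × ℝ≥0 | G.Adj e.1 e.2 ∧ e.1 ≤ n ∧ e.2 ≤ n}.Finite := by
  have happ {A : Set (ℝ≥0 × ℝ≥0)} (hA : MeasurableSet A) : adjacencyMeasure G A =
      ∑' e : {e : ℝ≥0 × ℝ≥0 // G.Adj e.1 e.2}, A.indicator 1 (e : ℝ≥0 × ℝ≥0) := by
    rw [adjacencyMeasure, Measure.sum_apply _ hA]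
    exact tsum_congr fun e => Measure.dirac_apply' _ hA
  constructor
  · intro h n
    have hm : MeasurableSet (Set.Iic (n : ℝ≥0) ×ˢ Set.Iic (n : ℝ≥0)) :=
      measurableSet_Iic.prod measurableSet_Iic
    have hb : Bornology.IsBounded (Set.Iic (n : ℝ≥0) ×ˢ Set.Iic (n : ℝ≥0)) := by
      have : Bornology.IsBounded (Set.Iic (n : ℝ≥0)) := by
        rw [← Set.Icc_bot]; exact Metric.isBounded_Icc _ _
      exact this.prod this
    have hlt := h _ hm hb
    rw [happ hm] at hlt
    have hfin := finite_of_tsum_ne_top hlt.ne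
      (s := {e | (e : ℝ≥0 × ℝ≥0) ∈ Set.Iic (n : ℝ≥0) ×ˢ Set.Iic (n : ℝ≥0)})
      (fun e he => Set.indicator_of_mem (show (e : ℝ≥0 × ℝ≥0) ∈ _ from he) _)
    refine (hfin.image Subtype.val).subset fun e he => ?_
    exact ⟨⟨e, he.1⟩, ⟨he.2.1, he.2.2⟩, rfl⟩
  · intro h A hA hb
    obtain ⟨r, hr⟩ := hb.subset_closedBall 0
    obtain ⟨n, hn⟩ := exists_nat_ge r
    have hsub : A ⊆ {e | e.1 ≤ (n : ℝ≥0) ∧ e.2 ≤ (n : ℝ≥0)} := fun e he => by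
      have h1 : dist e 0 ≤ n := (Metric.mem_closedBall.1 (hr he)).trans hn
      rw [Prod.dist_eq, max_le_iff] at h1
      have key (x : ℝ≥0) (hx : dist x 0 ≤ n) : x ≤ (n : ℝ≥0) := by
        rw [NNReal.dist_eq, NNReal.coe_zero, sub_zero] at hx
        exact_mod_cast (le_abs_self _).trans hx
      exact ⟨key _ h1.1, key _ h1.2⟩
    have hfin : {e : {e : ℝ≥0 × ℝ≥0 // G.Adj e.1 e.2} | (e : ℝ≥0 × ℝ≥0) ∈ A}.Finite :=
      Set.Finite.of_finite_image ((h n).subset (by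
        rintro _ ⟨e, he, rfl⟩
        exact ⟨e.2, hsub he⟩)) Subtype.val_injective.injOn
    rw [happ hA]
    rw [tsum_eq_sum (s := hfin.toFinset) fun e he => Set.indicator_of_notMem (by simpa using he) _]
    refine ENNReal.sum_lt_top.2 fun e _ => ?_
    exact (Set.indicator_le_self' (by simp) (e : ℝ≥0 × ℝ≥0) |>.trans
      (by simp : _ ≤ (1 : ℝ≥0∞))).trans_lt (by simp)

namespace Data

variable {Ω : Type*} [MeasurableSpace Ω]

/-! ### Connection probabilities of timed points -/

/-- The pairs of points with distinct birth times up to `T` and features in `A` and `B`. -/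
def timedPairs (T : ℝ≥0) (A B : Set Ω) : Set ((ℝ≥0 × Ω) × (ℝ≥0 × Ω)) :=
  {q | q.1.1 ≠ q.2.1} ∩ (Set.Iic T ×ˢ A) ×ˢ (Set.Iic T ×ˢ B)

lemma measurableSet_timedPairs (T : ℝ≥0) {A B : Set Ω} (hA : MeasurableSet A)
    (hB : MeasurableSet B) : MeasurableSet (timedPairs T A B) := by
  refine MeasurableSet.inter ?_
    ((measurableSet_Iic.prod hA).prod (measurableSet_Iic.prod hB))
  exact (measurableSet_eq_fun (measurable_fst.comp measurable_fst)
    (measurable_fst.comp measurable_snd)).compl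

/-- The connection probability of two points, set to zero outside of `timedPairs`. It vanishes on
the diagonal, so that a sum over all pairs of points is a sum over pairs of different points. -/
def edgeWeight (𝕎 : Data Ω) (T : ℝ≥0) (A B : Set Ω) (z z' : ℝ≥0 × Ω) : ℝ≥0∞ :=
  (timedPairs T A B).indicator (fun q => (𝕎.W q.1.2 q.2.2 : ℝ≥0∞)) (z, z')

variable (𝕎 : Data Ω) (μ : Measure Ω)

lemma measurable_edgeWeight (T : ℝ≥0) {A B : Set Ω} (hA : MeasurableSet A)
    (hB : MeasurableSet B) : Measurable (Function.uncurry (𝕎.edgeWeight T A B)) :=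
  (𝕎.measurable_coe_W.comp ((measurable_snd.comp measurable_fst).prodMk
    (measurable_snd.comp measurable_snd))).indicator (measurableSet_timedPairs T hA hB)

lemma edgeWeight_self (T : ℝ≥0) (A B : Set Ω) (z : ℝ≥0 × Ω) : 𝕎.edgeWeight T A B z z = 0 :=
  Set.indicator_of_notMem (fun h => h.1 rfl) _

lemma edgeWeight_comm (T : ℝ≥0) (A : Set Ω) (z z' : ℝ≥0 × Ω) :
    𝕎.edgeWeight T A A z z' = 𝕎.edgeWeight T A A z' z := by
  have h (z z' : ℝ≥0 × Ω) (hz : (z, z') ∈ timedPairs T A A) : (z', z) ∈ timedPairs T A A :=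
    ⟨Ne.symm hz.1, hz.2.2, hz.2.1⟩
  by_cases hz : (z, z') ∈ timedPairs T A A
  · rw [edgeWeight, edgeWeight, Set.indicator_of_mem hz, Set.indicator_of_mem (h _ _ hz),
      𝕎.symm_W]
  · rw [edgeWeight, edgeWeight, Set.indicator_of_notMem hz,
      Set.indicator_of_notMem fun hz' => hz (h _ _ hz')]

lemma edgeWeight_le_one (T : ℝ≥0) (A B : Set Ω) (z z' : ℝ≥0 × Ω) :
    𝕎.edgeWeight T A B z z' ≤ 1 :=
  Set.indicator_apply_le' (fun _ => 𝕎.coe_W_le_one _ _) fun _ => by simp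

lemma lintegral_edgeWeight [SigmaFinite μ] (T : ℝ≥0) {A B : Set Ω}
    (hB : MeasurableSet B) (z : ℝ≥0 × Ω) :
    ∫⁻ z', 𝕎.edgeWeight T A B z z' ∂(lebesgue.prod μ) =
      (Set.Iic T ×ˢ A).indicator (fun z => T * ∫⁻ y in B, (𝕎.W z.2 y : ℝ≥0∞) ∂μ) z := by
  by_cases hz : z ∈ Set.Iic T ×ˢ A
  · rw [Set.indicator_of_mem hz]
    have hm : MeasurableSet (Set.Iic T \ {z.1}) :=
      measurableSet_Iic.diff (measurableSet_singleton _)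
    have heq (z' : ℝ≥0 × Ω) : 𝕎.edgeWeight T A B z z' =
        (Set.Iic T \ {z.1}).indicator 1 z'.1 *
          B.indicator (fun y => (𝕎.W z.2 y : ℝ≥0∞)) z'.2 := by
      by_cases h1 : z'.1 ∈ Set.Iic T \ {z.1}
      · by_cases h2 : z'.2 ∈ B
        · rw [edgeWeight, Set.indicator_of_mem h1, Set.indicator_of_mem h2,
            Set.indicator_of_mem (show (z, z') ∈ timedPairs T A B from
              ⟨fun h => h1.2 h.symm, hz, h1.1, h2⟩)]
          simp
        · rw [edgeWeight, Set.indicator_of_notMem h2,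
            Set.indicator_of_notMem fun h : (z, z') ∈ timedPairs T A B => h2 h.2.2.2, mul_zero]
      · rw [edgeWeight, Set.indicator_of_notMem h1, Set.indicator_of_notMem
          fun h : (z, z') ∈ timedPairs T A B => h1 ⟨h.2.2.1, fun e => h.1 e.symm⟩, zero_mul]
    have hW : Measurable fun y => (𝕎.W z.2 y : ℝ≥0∞) :=
      𝕎.measurable_coe_W.comp measurable_prodMk_left
    rw [lintegral_congr heq, lintegral_prod_mul (measurable_one.indicator hm).aemeasurable
      (hW.indicator hB).aemeasurable, lintegral_indicator_one hm, lintegral_indicator hB,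
      measure_sdiff_null (lebesgue_singleton _), lebesgue_Iic]
  · rw [Set.indicator_of_notMem hz]
    refine (lintegral_congr fun z' => ?_).trans lintegral_zero
    exact Set.indicator_of_notMem (fun h => hz h.2.1) _

lemma lintegral_lintegral_edgeWeight [SigmaFinite μ] (T : ℝ≥0) {A B : Set Ω}
    (hA : MeasurableSet A) (hB : MeasurableSet B) :
    ∫⁻ z, ∫⁻ z', 𝕎.edgeWeight T A B z z' ∂(lebesgue.prod μ) ∂(lebesgue.prod μ) =
      T * (T * 𝕎.massW μ A B) := by
  have hm := 𝕎.measurable_lintegral_W μ B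
  have heq (z : ℝ≥0 × Ω) : ∫⁻ z', 𝕎.edgeWeight T A B z z' ∂(lebesgue.prod μ) =
      (Set.Iic T).indicator 1 z.1 *
        A.indicator (fun x => T * ∫⁻ y in B, (𝕎.W x y : ℝ≥0∞) ∂μ) z.2 := by
    rw [𝕎.lintegral_edgeWeight μ T hB]
    by_cases h1 : z.1 ∈ Set.Iic T
    · by_cases h2 : z.2 ∈ A
      · rw [Set.indicator_of_mem h1, Set.indicator_of_mem h2,
          Set.indicator_of_mem (show z ∈ Set.Iic T ×ˢ A from ⟨h1, h2⟩)]
        simp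
      · rw [Set.indicator_of_notMem h2,
          Set.indicator_of_notMem fun h : z ∈ Set.Iic T ×ˢ A => h2 h.2, mul_zero]
    · rw [Set.indicator_of_notMem h1,
        Set.indicator_of_notMem fun h : z ∈ Set.Iic T ×ˢ A => h1 h.1, zero_mul]
  rw [lintegral_congr heq, lintegral_prod_mul
    (measurable_one.indicator measurableSet_Iic).aemeasurable
    ((hm.const_mul _).indicator hA).aemeasurable, lintegral_indicator_one measurableSet_Iic,
    lintegral_indicator hA, lintegral_const_mul _ hm, lebesgue_Iic, massW]

/-! ### Local finiteness of the graph under conditions (1) and (2) -/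

variable [SigmaFinite μ]

/-- If `∫∫ W` over `A × B` is finite, then the expected number of edges up to time `T` between
points with features in `A` and points with features in `B` is finite. -/
lemma ae_finite_edges (T : ℝ≥0) {A B : Set Ω} (hA : MeasurableSet A) (hB : MeasurableSet B)
    (h : 𝕎.massW μ A B < ∞) :
    ∀ᵐ ω ∂(𝕎.sampleLaw μ), {pq : ω.points.Index × ω.points.Index |
      (ω.points.point pq.1, ω.points.point pq.2) ∈ timedPairs T A B ∧
      (ω.coins s(ω.points.label pq.1, ω.points.label pq.2) : ℝ) <
        𝕎.W (ω.points.point pq.1).2 (ω.points.point pq.2).2}.Finite := by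
  set E : Set (((ℝ≥0 × Ω) × (ℝ≥0 × Ω)) × unitInterval) :=
    {r | r.1 ∈ timedPairs T A B ∧ (r.2 : ℝ) < 𝕎.W r.1.1.2 r.1.2.2} with hE
  have hEm : MeasurableSet E := by
    refine MeasurableSet.inter (measurable_fst (measurableSet_timedPairs T hA hB))
      (measurableSet_lt (measurable_subtype_coe.comp measurable_snd) ?_)
    exact (𝕎.measurable_W.comp (((measurable_snd.comp measurable_fst).comp measurable_fst).prodMk
      ((measurable_snd.comp measurable_snd).comp measurable_fst))).coe_nnreal_real
  have hind : Measurable (E.indicator (1 : _ × _ → ℝ≥0∞)) := measurable_one.indicator hEm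
  let X (ω : Outcome Ω) : ℝ≥0∞ := ∑' p : ω.points.Index, ∑' q : ω.points.Index,
    E.indicator 1 ((ω.points.point p, ω.points.point q),
      ω.coins s(ω.points.label p, ω.points.label q))
  have hcoin (e : Sym2 (ℕ × ℕ)) : Measurable fun ω : Outcome Ω => ω.coins e :=
    (measurable_pi_apply e).comp (measurable_fst.comp measurable_snd)
  have hX : Measurable X := by
    refine measurable_tsum_index (C := fun ω : Outcome Ω => ω.points) measurable_fst
      (F := fun a ω x => ∑' q : ω.points.Index,
        E.indicator 1 ((x, ω.points.point q), ω.coins s(a, ω.points.label q))) fun a => ?_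
    refine measurable_tsum_index (C := fun r : Outcome Ω × (ℝ≥0 × Ω) => r.1.points)
      (measurable_fst.comp measurable_fst)
      (F := fun b r y => E.indicator 1 ((r.2, y), r.1.coins s(a, b))) fun b => ?_
    refine hind.comp (f := fun r : (Outcome Ω × (ℝ≥0 × Ω)) × (ℝ≥0 × Ω) =>
      ((r.1.2, r.2), r.1.1.coins s(a, b))) ?_
    exact ((measurable_snd.comp measurable_fst).prodMk measurable_snd).prodMk
      ((hcoin _).comp (measurable_fst.comp measurable_fst))
  have hXint : ∫⁻ ω, X ω ∂(𝕎.sampleLaw μ) = T * (T * 𝕎.massW μ A B) := by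
    rw [sampleLaw, lintegral_prod _ hX.aemeasurable,
      ← 𝕎.lintegral_lintegral_edgeWeight μ T hA hB,
      ← lintegral_config_sum_sum (lebesgue.prod μ) (𝕎.measurable_edgeWeight T hA hB)
        (𝕎.edgeWeight_self T A B)]
    refine lintegral_congr fun c => ?_
    have hm (e : Sym2 (ℕ × ℕ)) (z z' : ℝ≥0 × Ω) : Measurable fun r :
        (Sym2 (ℕ × ℕ) → unitInterval) × (ℕ × ℕ → Config (ℝ≥0 × ℝ≥0)) × Config (ℝ≥0 × ℝ≥0) =>
          E.indicator (1 : _ × _ → ℝ≥0∞) ((z, z'), r.1 e) :=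
      hind.comp (measurable_const.prodMk ((measurable_pi_apply e).comp measurable_fst))
    change ∫⁻ r : (Sym2 (ℕ × ℕ) → unitInterval) × (ℕ × ℕ → Config (ℝ≥0 × ℝ≥0)) ×
      Config (ℝ≥0 × ℝ≥0), ∑' p : Config.Index c, ∑' q : Config.Index c,
        E.indicator 1 ((c.point p, c.point q), r.1 s(c.label p, c.label q)) ∂_ = _
    rw [lintegral_tsum fun p => (Measurable.tsum fun q => hm _ _ _).aemeasurable]
    refine tsum_congr fun p => ?_
    rw [lintegral_tsum fun q => (hm _ _ _).aemeasurable]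
    refine tsum_congr fun q => ?_
    have hm1 : Measurable fun u : unitInterval =>
        E.indicator (1 : _ × _ → ℝ≥0∞) ((c.point p, c.point q), u) := hind.comp measurable_prodMk_left
    rw [measurePreserving_fst.lintegral_comp (f := fun f : Sym2 (ℕ × ℕ) → unitInterval =>
        E.indicator (1 : _ × _ → ℝ≥0∞) ((c.point p, c.point q), f s(c.label p, c.label q)))
        (hm1.comp (measurable_pi_apply _)),
      (measurePreserving_eval_infinitePi (fun _ : Sym2 (ℕ × ℕ) => (volume : Measure unitInterval))
        s(c.label p, c.label q)).lintegral_comp hm1]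
    rw [lintegral_indicator_one_prodMk _ hEm, edgeWeight]
    by_cases hpq : (c.point p, c.point q) ∈ timedPairs T A B
    · rw [Set.indicator_of_mem hpq, ← volume_coin_lt (𝕎.W_le_one _ _)]
      congr 1
      ext u
      exact and_iff_right hpq
    · rw [Set.indicator_of_notMem hpq]
      exact (congrArg _ (Set.eq_empty_of_forall_notMem fun u hu => hpq hu.1)).trans
        measure_empty
  have hfin : ∫⁻ ω, X ω ∂(𝕎.sampleLaw μ) ≠ ∞ := by
    rw [hXint]
    exact ENNReal.mul_ne_top (by simp) (ENNReal.mul_ne_top (by simp) h.ne)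
  filter_upwards [ae_lt_top hX hfin] with ω hω
  simp only [X] at hω
  rw [← ENNReal.tsum_prod] at hω
  exact finite_of_tsum_ne_top hω.ne fun pq hpq => Set.indicator_of_mem
    (show ((ω.points.point pq.1, ω.points.point pq.2), _) ∈ E from hpq) _

/-- If `∫ S` over `A` is finite, then the expected number of leaves up to time `T` attached to
points with features in `A` is finite. -/
lemma ae_finite_leaves (T : ℝ≥0) {A : Set Ω} (hA : MeasurableSet A)
    (h : ∫⁻ x in A, (𝕎.S x : ℝ≥0∞) ∂μ < ∞) :
    ∀ᵐ ω ∂(𝕎.sampleLaw μ), {pq : Σ p : ω.points.Index, (ω.stars (ω.points.label p)).Index |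
      ω.points.point pq.1 ∈ Set.Iic T ×ˢ A ∧
      (ω.stars (ω.points.label pq.1)).point pq.2 ∈
        Set.Iic T ×ˢ Set.Iio (𝕎.S (ω.points.point pq.1).2)}.Finite := by
  set E : Set ((ℝ≥0 × Ω) × (ℝ≥0 × ℝ≥0)) :=
    {r | r.1 ∈ Set.Iic T ×ˢ A ∧ r.2 ∈ Set.Iic T ×ˢ Set.Iio (𝕎.S r.1.2)} with hE
  have hEm : MeasurableSet E := by
    refine MeasurableSet.inter (measurable_fst (measurableSet_Iic.prod hA)) (MeasurableSet.inter
      ((measurable_fst.comp measurable_snd) measurableSet_Iic) ?_)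
    exact measurableSet_lt (measurable_snd.comp measurable_snd)
      (𝕎.measurable_S.comp (measurable_snd.comp measurable_fst))
  have hind : Measurable (E.indicator (1 : _ × _ → ℝ≥0∞)) := measurable_one.indicator hEm
  let X (ω : Outcome Ω) : ℝ≥0∞ := ∑' p : ω.points.Index,
    ∑' q : (ω.stars (ω.points.label p)).Index,
      E.indicator 1 (ω.points.point p, (ω.stars (ω.points.label p)).point q)
  have hX : Measurable X := by
    refine measurable_tsum_index (C := fun ω : Outcome Ω => ω.points) measurable_fst
      (F := fun a ω x => ∑' q : (ω.stars a).Index,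
        E.indicator 1 (x, (ω.stars a).point q)) fun a => ?_
    refine measurable_tsum_index (C := fun r : Outcome Ω × (ℝ≥0 × Ω) => r.1.stars a)
      ((measurable_pi_apply a).comp ((measurable_fst.comp (measurable_snd.comp
        measurable_snd)).comp measurable_fst))
      (F := fun _ r y => E.indicator 1 (r.2, y)) fun b => ?_
    exact hind.comp ((measurable_snd.comp measurable_fst).prodMk measurable_snd)
  have hXint : ∫⁻ ω, X ω ∂(𝕎.sampleLaw μ) =
      T * (T * ∫⁻ x in A, (𝕎.S x : ℝ≥0∞) ∂μ) := by
    set g : ℝ≥0 × Ω → ℝ≥0∞ := fun z =>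
      (Set.Iic T).indicator 1 z.1 * A.indicator (fun x => T * (𝕎.S x : ℝ≥0∞)) z.2 with hg
    have hg1 : Measurable ((Set.Iic T).indicator (1 : ℝ≥0 → ℝ≥0∞)) :=
      measurable_one.indicator measurableSet_Iic
    have hg2 : Measurable (A.indicator fun x => T * (𝕎.S x : ℝ≥0∞)) :=
      (𝕎.measurable_coe_S.const_mul _).indicator hA
    have hgint : ∫⁻ z, g z ∂(lebesgue.prod μ) = T * (T * ∫⁻ x in A, (𝕎.S x : ℝ≥0∞) ∂μ) := by
      rw [hg, lintegral_prod_mul hg1.aemeasurable hg2.aemeasurable,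
        lintegral_indicator_one measurableSet_Iic, lintegral_indicator hA,
        lintegral_const_mul _ 𝕎.measurable_coe_S, lebesgue_Iic]
    rw [sampleLaw, lintegral_prod _ hX.aemeasurable, ← hgint,
      ← lintegral_config_sum (lebesgue.prod μ) (f := g)
        ((hg1.comp measurable_fst).mul (hg2.comp measurable_snd))]
    refine lintegral_congr fun c => ?_
    have hz (z : ℝ≥0 × Ω) : Measurable fun y => E.indicator (1 : _ × _ → ℝ≥0∞) (z, y) :=
      hind.comp measurable_prodMk_left
    have hs (z : ℝ≥0 × Ω) : Measurable fun d : Config (ℝ≥0 × ℝ≥0) =>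
        d.sum fun y => E.indicator (1 : _ × _ → ℝ≥0∞) (z, y) :=
      measurable_config_sum measurable_id
        (F := fun _ y => E.indicator (1 : _ × _ → ℝ≥0∞) (z, y)) ((hz z).comp measurable_snd)
    change ∫⁻ r : (Sym2 (ℕ × ℕ) → unitInterval) × (ℕ × ℕ → Config (ℝ≥0 × ℝ≥0)) ×
      Config (ℝ≥0 × ℝ≥0), ∑' p : Config.Index c, Config.sum (r.2.1 (c.label p))
        (fun y => E.indicator (1 : _ × _ → ℝ≥0∞) (c.point p, y)) ∂_ = _
    have hs' (a : ℕ × ℕ) (z : ℝ≥0 × Ω) : Measurable fun r : (Sym2 (ℕ × ℕ) → unitInterval) ×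
        (ℕ × ℕ → Config (ℝ≥0 × ℝ≥0)) × Config (ℝ≥0 × ℝ≥0) => Config.sum (r.2.1 a)
          (fun y => E.indicator (1 : _ × _ → ℝ≥0∞) (z, y)) :=
      (hs z).comp ((measurable_pi_apply a).comp (measurable_fst.comp measurable_snd))
    rw [lintegral_tsum fun p => (hs' _ _).aemeasurable]
    refine tsum_congr fun p => ?_
    rw [measurePreserving_snd.lintegral_comp (f := fun r : (ℕ × ℕ → Config (ℝ≥0 × ℝ≥0)) ×
        Config (ℝ≥0 × ℝ≥0) => Config.sum (r.1 (c.label p))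
          (fun y => E.indicator (1 : _ × _ → ℝ≥0∞) (c.point p, y)))
        ((hs _).comp ((measurable_pi_apply _).comp measurable_fst)),
      measurePreserving_fst.lintegral_comp (f := fun r : ℕ × ℕ → Config (ℝ≥0 × ℝ≥0) =>
        Config.sum (r (c.label p)) (fun y => E.indicator (1 : _ × _ → ℝ≥0∞) (c.point p, y)))
        ((hs _).comp (measurable_pi_apply _)),
      (measurePreserving_eval_infinitePi (fun _ : ℕ × ℕ => poissonLaw (lebesgue.prod lebesgue))
        (c.label p)).lintegral_comp (hs _), lintegral_config_sum _ (hz _)]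
    rw [lintegral_indicator_one_prodMk _ hEm]
    by_cases h1 : (c.point p).1 ∈ Set.Iic T
    · by_cases h2 : (c.point p).2 ∈ A
      · simp only [hg]
        rw [Set.indicator_of_mem h1, Set.indicator_of_mem h2, Pi.one_apply, one_mul]
        have : Prod.mk (c.point p) ⁻¹' E = Set.Iic T ×ˢ Set.Iio (𝕎.S (c.point p).2) := by
          ext y
          exact and_iff_right ⟨h1, h2⟩
        rw [this, Measure.prod_prod, lebesgue_Iic, lebesgue_Iio]
      · simp only [hg]
        rw [Set.indicator_of_notMem h2, mul_zero]
        exact (congrArg _ (Set.eq_empty_of_forall_notMem fun u hu => h2 hu.1.2)).trans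
          measure_empty
    · simp only [hg]
      rw [Set.indicator_of_notMem h1, zero_mul]
      exact (congrArg _ (Set.eq_empty_of_forall_notMem fun u hu => h1 hu.1.1)).trans
        measure_empty
  have hfin : ∫⁻ ω, X ω ∂(𝕎.sampleLaw μ) ≠ ∞ := by
    rw [hXint]
    exact ENNReal.mul_ne_top (by simp) (ENNReal.mul_ne_top (by simp) h.ne)
  filter_upwards [ae_lt_top hX hfin] with ω hω
  simp only [X] at hω
  rw [← ENNReal.tsum_sigma (fun (p : ω.points.Index) (q : (ω.stars (ω.points.label p)).Index) =>
    E.indicator (1 : _ × _ → ℝ≥0∞)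
      (ω.points.point p, (ω.stars (ω.points.label p)).point q))] at hω
  exact finite_of_tsum_ne_top hω.ne fun pq hpq => Set.indicator_of_mem
    (show (ω.points.point pq.1, _) ∈ E from hpq) _

lemma ae_finite_dust (T : ℝ≥0) : ∀ᵐ ω ∂(𝕎.sampleLaw μ),
    {q : ω.dust.Index | ω.dust.point q ∈ Set.Iic T ×ˢ Set.Iic T}.Finite := by
  have h := ae_finite_points (𝕎.I • lebesgue.prod lebesgue)
    (measurableSet_Iic.prod measurableSet_Iic : MeasurableSet (Set.Iic T ×ˢ Set.Iic T)) (by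
      rw [Measure.smul_apply, Measure.prod_prod, lebesgue_Iic]
      exact ENNReal.mul_lt_top (by simp) (ENNReal.mul_lt_top (by simp) (by simp)))
  exact (Measure.quasiMeasurePreserving_snd.comp (Measure.quasiMeasurePreserving_snd.comp
    Measure.quasiMeasurePreserving_snd)).ae h

/-- Outside of the set `A` of condition (2) there are only finitely many points up to time `T`, so
they have bounded degrees and star intensities, and the expected number of edges or leaves of
points within given bounds is finite. -/
theorem ae_locallyFinite (h₁ : 𝕎.LocallyFinite₁ μ) (h₂ : 𝕎.LocallyFinite₂ μ) :
    ∀ᵐ ω ∂(𝕎.sampleLaw μ), LocallyFiniteMeasure (adjacencyMeasure (𝕎.graph ω)) := by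
  rw [locallyFinite₁_iff] at h₁
  obtain ⟨A, hA, hAc, hW, hS⟩ := (𝕎.locallyFinite₂_iff μ).1 h₂
  let B (k : ℕ) : Set Ω := Aᶜ ∩ {x | 𝕎.degW μ x ≤ k}
  let C (k : ℕ) : Set Ω := Aᶜ ∩ {x | (𝕎.S x : ℝ≥0∞) ≤ k}
  have hB (k) : MeasurableSet (B k) :=
    hA.compl.inter (measurableSet_le (𝕎.measurable_degW μ) measurable_const)
  have hC (k) : MeasurableSet (C k) :=
    hA.compl.inter (measurableSet_le 𝕎.measurable_coe_S measurable_const)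
  have hWB (k) : 𝕎.massW μ (B k) Set.univ < ∞ :=
    (𝕎.massW_le_of_degW_le μ _ fun x hx => hx.2).trans_lt
      (ENNReal.mul_lt_top (by simp) ((measure_mono Set.inter_subset_left).trans_lt hAc))
  have hWB' (k) : 𝕎.massW μ Set.univ (B k) < ∞ := by
    rw [massW_comm]; exact hWB k
  have hSC (k) : ∫⁻ x in C k, (𝕎.S x : ℝ≥0∞) ∂μ < ∞ := by
    refine (setLIntegral_mono measurable_const fun x hx => hx.2).trans_lt ?_
    rw [setLIntegral_const]
    exact ENNReal.mul_lt_top (by simp) ((measure_mono Set.inter_subset_left).trans_lt hAc)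
  have hpts (n : ℕ) : ∀ᵐ ω ∂(𝕎.sampleLaw μ),
      {p : ω.points.Index | ω.points.point p ∈ Set.Iic (n : ℝ≥0) ×ˢ Aᶜ}.Finite := by
    have := ae_finite_points (lebesgue.prod μ) (measurableSet_Iic.prod hA.compl :
      MeasurableSet (Set.Iic (n : ℝ≥0) ×ˢ Aᶜ)) (by
        rw [Measure.prod_prod, lebesgue_Iic]
        exact ENNReal.mul_lt_top (by simp) hAc)
    exact Measure.quasiMeasurePreserving_fst.ae this
  have hdeg : ∀ᵐ ω ∂(𝕎.sampleLaw μ), ∀ p : ω.points.Index,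
      𝕎.degW μ (ω.points.point p).2 < ∞ := by
    have := ae_forall_points (lebesgue.prod μ) (q := fun z => 𝕎.degW μ z.2 < ∞)
      (Measure.quasiMeasurePreserving_snd.ae h₁)
    exact Measure.quasiMeasurePreserving_fst.ae this
  filter_upwards [hdeg, ae_all_iff.2 hpts, ae_all_iff.2 fun n : ℕ => 𝕎.ae_finite_dust μ n,
    ae_all_iff.2 fun n : ℕ => 𝕎.ae_finite_edges μ n hA hA hW,
    ae_all_iff.2 fun n : ℕ => ae_all_iff.2 fun k : ℕ =>
      𝕎.ae_finite_edges μ n (hB k) MeasurableSet.univ (hWB k),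
    ae_all_iff.2 fun n : ℕ => ae_all_iff.2 fun k : ℕ =>
      𝕎.ae_finite_edges μ n MeasurableSet.univ (hB k) (hWB' k),
    ae_all_iff.2 fun n : ℕ => 𝕎.ae_finite_leaves μ n hA hS,
    ae_all_iff.2 fun n : ℕ => ae_all_iff.2 fun k : ℕ => 𝕎.ae_finite_leaves μ n (hC k) (hSC k)]
    with ω hdeg hpts hdust hAA hBU hUB hSA hSC
  rw [locallyFinite_adjacencyMeasure_iff]
  intro n
  -- a common bound for the finitely many points outside of `A`
  obtain ⟨k, hk⟩ : ∃ k : ℕ, ∀ p : ω.points.Index, ω.points.point p ∈ Set.Iic (n : ℝ≥0) ×ˢ Aᶜ →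
      𝕎.degW μ (ω.points.point p).2 ≤ k ∧ (𝕎.S (ω.points.point p).2 : ℝ≥0∞) ≤ k := by
    have hb (p : ω.points.Index) : ∃ k : ℕ,
        𝕎.degW μ (ω.points.point p).2 + 𝕎.S (ω.points.point p).2 ≤ k := by
      obtain ⟨k, hk⟩ := ENNReal.exists_nat_gt
        (ENNReal.add_ne_top.2 ⟨(hdeg p).ne, ENNReal.coe_ne_top (r := 𝕎.S (ω.points.point p).2)⟩)
      exact ⟨k, hk.le⟩
    choose f hf using hb
    obtain ⟨k, hk⟩ := ((hpts n).image f).bddAbove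
    refine ⟨k, fun p hp => ?_⟩
    have : (f p : ℝ≥0∞) ≤ k := Nat.cast_le.2 (hk ⟨p, hp, rfl⟩)
    exact ⟨le_self_add.trans ((hf p).trans this), le_add_self.trans ((hf p).trans this)⟩
  let V : Set (ω.points.Index × ω.points.Index) := {pq |
    (ω.points.point pq.1, ω.points.point pq.2) ∈ timedPairs (n : ℝ≥0) Set.univ Set.univ ∧
      (ω.coins s(ω.points.label pq.1, ω.points.label pq.2) : ℝ) <
        𝕎.W (ω.points.point pq.1).2 (ω.points.point pq.2).2}
  have hV : V.Finite := by
    refine ((hAA n).union ((hBU n k).union (hUB n k))).subset ?_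
    rintro ⟨p, q⟩ ⟨⟨hne, hp, hq⟩, hlt⟩
    by_cases hpA : (ω.points.point p).2 ∈ A
    · by_cases hqA : (ω.points.point q).2 ∈ A
      · exact .inl ⟨⟨hne, ⟨hp.1, hpA⟩, ⟨hq.1, hqA⟩⟩, hlt⟩
      · exact .inr (.inr ⟨⟨hne, hp, ⟨hq.1, hqA, (hk q ⟨hq.1, hqA⟩).1⟩⟩, hlt⟩)
    · exact .inr (.inl ⟨⟨hne, ⟨hp.1, hpA, (hk p ⟨hp.1, hpA⟩).1⟩, hq⟩, hlt⟩)
  let L : Set (Σ p : ω.points.Index, (ω.stars (ω.points.label p)).Index) := {pq |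
    ω.points.point pq.1 ∈ Set.Iic (n : ℝ≥0) ×ˢ Set.univ ∧
      (ω.stars (ω.points.label pq.1)).point pq.2 ∈
        Set.Iic (n : ℝ≥0) ×ˢ Set.Iio (𝕎.S (ω.points.point pq.1).2)}
  have hL : L.Finite := by
    refine ((hSA n).union (hSC n k)).subset ?_
    rintro ⟨p, q⟩ ⟨hp, hq⟩
    by_cases hpA : (ω.points.point p).2 ∈ A
    · exact .inl ⟨⟨hp.1, hpA⟩, hq⟩
    · exact .inr ⟨⟨hp.1, hpA, (hk p ⟨hp.1, hpA⟩).2⟩, hq⟩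
  set R : Set (ℝ≥0 × ℝ≥0) :=
    (fun pq : ω.points.Index × ω.points.Index =>
      ((ω.points.point pq.1).1, (ω.points.point pq.2).1)) '' V ∪
    ((fun pq : Σ p : ω.points.Index, (ω.stars (ω.points.label p)).Index =>
      ((ω.points.point pq.1).1, ((ω.stars (ω.points.label pq.1)).point pq.2).1)) '' L ∪
    ω.dust.point '' {q | ω.dust.point q ∈ Set.Iic (n : ℝ≥0) ×ˢ Set.Iic (n : ℝ≥0)}) with hR
  have hRfin : R.Finite := (hV.image _).union ((hL.image _).union ((hdust n).image _))
  have hrel {a b : ℝ≥0} (hab : a ≠ b) (ha : a ≤ n) (hb : b ≤ n) (h : 𝕎.edgeRel ω a b) :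
      (a, b) ∈ R := by
    rcases h with ⟨p, q, -, rfl, rfl, hlt⟩ | ⟨p, rfl, q, hlt, rfl⟩ | ⟨q, rfl, rfl⟩
    · exact .inl ⟨(p, q), ⟨⟨hab, ⟨ha, trivial⟩, hb, trivial⟩, hlt⟩, rfl⟩
    · exact .inr (.inl ⟨⟨p, q⟩, ⟨⟨ha, trivial⟩, hb, hlt⟩, rfl⟩)
    · exact .inr (.inr ⟨q, ⟨ha, hb⟩, rfl⟩)
  refine (hRfin.union (hRfin.image Prod.swap)).subset ?_
  rintro ⟨a, b⟩ ⟨hadj, ha, hb⟩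
  obtain ⟨hne, h | h⟩ := (SimpleGraph.fromRel_adj _ _ _).1 hadj
  · exact .inl (hrel hne ha hb h)
  · exact .inr ⟨(b, a), hrel hne.symm hb ha h, rfl⟩

end Data

/-! ### Infinitely many edges from divergent connection probabilities -/

lemma tsum_sym2_mk_le {α : Type*} (f : Sym2 α → ℝ≥0∞) :
    ∑' x : α × α, f s(x.1, x.2) ≤ 2 * ∑' e, f e := by
  classical
  let : LinearOrder α := IsWellOrder.linearOrder WellOrderingRel
  have hinj : Function.Injective fun x : α × α => (s(x.1, x.2), decide (x.1 ≤ x.2)) := by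
    rintro ⟨a, b⟩ ⟨c, d⟩ h
    obtain ⟨h1, h2⟩ := Prod.mk.inj h
    rcases Sym2.eq_iff.1 h1 with ⟨h3, h4⟩ | ⟨h3, h4⟩
    · exact Prod.ext h3 h4
    · simp only at h2 h3 h4
      subst h3 h4
      have hab : a = b := by
        rw [decide_eq_decide] at h2
        rcases le_total a b with h | h
        · exact le_antisymm h (h2.1 h)
        · exact le_antisymm (h2.2 h) h
      subst hab
      rfl
  calc ∑' x : α × α, f s(x.1, x.2)
      ≤ ∑' y : Sym2 α × Bool, f y.1 :=
        ENNReal.tsum_comp_le_tsum_of_injective hinj fun y : Sym2 α × Bool => f y.1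
    _ = 2 * ∑' e, f e := by
        rw [ENNReal.tsum_prod (f := fun e (_ : Bool) => f e), ← ENNReal.tsum_mul_left]
        refine tsum_congr fun e => ?_
        rw [tsum_fintype]
        simp [two_mul]

namespace Data

variable {Ω : Type*} [MeasurableSpace Ω] (𝕎 : Data Ω) (μ : Measure Ω) [SigmaFinite μ]

lemma ae_injective_times : ∀ᵐ c ∂(poissonLaw (lebesgue.prod μ)),
    Function.Injective fun p : Config.Index c => (c.point p).1 := by
  set E : Set ((ℝ≥0 × Ω) × (ℝ≥0 × Ω)) := {q | q.2.1 = q.1.1} with hE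
  have hEm : MeasurableSet E := measurableSet_eq_fun (measurable_fst.comp measurable_snd)
    (measurable_fst.comp measurable_fst)
  let v (z z' : ℝ≥0 × Ω) : ℝ≥0∞ := E.indicator 1 (z, z')
  have hv : Measurable (Function.uncurry v) := measurable_one.indicator hEm
  have hF : Measurable (Function.uncurry fun (z : ℝ≥0 × Ω) (c : Config (ℝ≥0 × Ω)) =>
      c.sum (v z)) :=
    measurable_config_sum (C := fun q : (ℝ≥0 × Ω) × Config (ℝ≥0 × Ω) => q.2) measurable_snd
      (F := fun q => v q.1) (hv.comp ((measurable_fst.comp measurable_fst).prodMk measurable_snd))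
  have h0 : ∫⁻ z, ∫⁻ c, Config.sum c (v z) ∂(poissonLaw (lebesgue.prod μ)) ∂(lebesgue.prod μ)
      = 0 := by
    refine (lintegral_congr fun z => ?_).trans lintegral_zero
    rw [lintegral_config_sum (f := v z) _ (hv.comp measurable_prodMk_left)]
    rw [lintegral_indicator_one_prodMk _ hEm]
    have : Prod.mk z ⁻¹' E = {z.1} ×ˢ Set.univ := by
      ext z'
      simp [hE]
    rw [this, Measure.prod_prod, lebesgue_singleton, zero_mul]
  rw [← mecke_poissonLaw _ hF, lintegral_eq_zero_iff (measurable_tsum_remove hF)] at h0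
  filter_upwards [h0] with c hc p q hpq
  by_contra hne
  have h1 : (c.remove p).sum (v (c.point p)) = 0 := ENNReal.tsum_eq_zero.1 hc p
  have h2 : c.sum (v (c.point p)) = 1 := by
    rw [c.sum_remove p, h1, add_zero]
    exact Set.indicator_of_mem (show (c.point p, c.point p) ∈ E from rfl) 1
  have h3 : ∑ r ∈ {p, q}, v (c.point p) (c.point r) ≤ c.sum (v (c.point p)) :=
    ENNReal.sum_le_tsum _
  rw [Finset.sum_pair hne, h2,
    show v (c.point p) (c.point p) = 1 from Set.indicator_of_mem (show _ ∈ E from rfl) 1,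
    show v (c.point p) (c.point q) = 1 from Set.indicator_of_mem (show _ ∈ E from hpq.symm) 1] at h3
  norm_num at h3

/-- The expected number (over the coins) of ordered pairs of adjacent points up to time `1`. -/
def expectedEdges (𝕎 : Data Ω) (c : Config (ℝ≥0 × Ω)) : ℝ≥0∞ :=
  c.sum fun z => c.sum (𝕎.edgeWeight 1 Set.univ Set.univ z)

/-- Given the points, the edges are independent, so their number is a.s. infinite if its
expectation is. -/
lemma ae_expectedEdges_lt_top
    (h : ∀ᵐ ω ∂(𝕎.sampleLaw μ), LocallyFiniteMeasure (adjacencyMeasure (𝕎.graph ω))) :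
    ∀ᵐ c ∂(poissonLaw (lebesgue.prod μ)), 𝕎.expectedEdges c < ∞ := by
  filter_upwards [Measure.ae_ae_of_ae_prod h, ae_injective_times μ] with c hc hinj
  by_contra htop
  rw [not_lt, top_le_iff] at htop
  let A (e : Sym2 (ℕ × ℕ)) : Set unitInterval := ⋃ (p : c.Index) (q : c.Index)
    (_ : e = s(c.label p, c.label q) ∧
      (c.point p, c.point q) ∈ timedPairs 1 Set.univ Set.univ),
    {u | (u : ℝ) < 𝕎.W (c.point p).2 (c.point q).2}
  have hA (e) : MeasurableSet (A e) :=
    .iUnion fun p => .iUnion fun q => .iUnion fun _ =>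
      measurableSet_lt measurable_subtype_coe measurable_const
  have hle (p q : c.Index) : 𝕎.edgeWeight 1 Set.univ Set.univ (c.point p) (c.point q) ≤
      volume (A s(c.label p, c.label q)) := by
    by_cases hpq : (c.point p, c.point q) ∈ timedPairs 1 Set.univ Set.univ
    · rw [edgeWeight, Set.indicator_of_mem hpq, ← volume_coin_lt (𝕎.W_le_one _ _)]
      refine measure_mono fun u hu => ?_
      simp only [A, Set.mem_iUnion]
      exact ⟨p, q, ⟨rfl, hpq⟩, hu⟩
    · rw [edgeWeight, Set.indicator_of_notMem hpq]
      exact zero_le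
  have hsum : ∑' e, (volume : Measure unitInterval) (A e) = ∞ := by
    have h1 : 𝕎.expectedEdges c ≤ ∑' x : (ℕ × ℕ) × (ℕ × ℕ),
        volume (A s(x.1, x.2)) := by
      calc 𝕎.expectedEdges c
          ≤ ∑' (p : c.Index) (q : c.Index), volume (A s(c.label p, c.label q)) :=
            ENNReal.tsum_le_tsum fun p => ENNReal.tsum_le_tsum fun q => hle p q
        _ = ∑' pq : c.Index × c.Index, volume (A s(c.label pq.1, c.label pq.2)) :=
            ENNReal.tsum_prod.symm
        _ ≤ _ := ENNReal.tsum_comp_le_tsum_of_injective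
            (c.label_injective.prodMap c.label_injective)
            fun x : (ℕ × ℕ) × (ℕ × ℕ) => volume (A s(x.1, x.2))
    have h2 := tsum_sym2_mk_le fun e => volume (A e)
    have h3 := (htop.symm.le.trans h1).trans h2
    rw [top_le_iff, ENNReal.mul_eq_top] at h3
    simpa using h3
  have hinf := ae_infinite_of_tsum_eq_top (fun _ : Sym2 (ℕ × ℕ) =>
    (volume : Measure unitInterval)) hA hsum
  obtain ⟨coins, hlf, hcoins⟩ := ((Measure.ae_ae_of_ae_prod hc).and hinf).exists
  obtain ⟨r, hr⟩ := hlf.exists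
  have hF := (locallyFinite_adjacencyMeasure_iff _).1 hr 1
  refine hcoins (((hF.preimage (hinj.prodMap hinj).injOn).image
    fun pq : c.Index × c.Index => s(c.label pq.1, c.label pq.2)).subset fun e he => ?_)
  have he' : coins e ∈ A e := he
  simp only [A, Set.mem_iUnion] at he'
  obtain ⟨p, q, ⟨rfl, hpq⟩, hu⟩ := he'
  refine ⟨(p, q), ⟨?_, ?_, ?_⟩, rfl⟩
  · refine (SimpleGraph.fromRel_adj _ _ _).2 ⟨hpq.1, .inl (.inl ⟨p, q, ?_, rfl, rfl, hu⟩)⟩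
    rintro rfl
    exact hpq.1 rfl
  · simpa using hpq.2.1.1
  · simpa using hpq.2.2.1

/-- Given the points, the events that a point has a leaf born in `(1, 2]` are independent, with
probabilities comparable to `min S 1`. -/
lemma ae_sum_min_S_lt_top
    (h : ∀ᵐ ω ∂(𝕎.sampleLaw μ), LocallyFiniteMeasure (adjacencyMeasure (𝕎.graph ω))) :
    ∀ᵐ c ∂(poissonLaw (lebesgue.prod μ)), Config.sum c (fun z =>
      (Set.Iic 1).indicator 1 z.1 * min (𝕎.S z.2 : ℝ≥0∞) 1) < ∞ := by
  filter_upwards [Measure.ae_ae_of_ae_prod h, ae_injective_times μ] with c hc hinj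
  by_contra htop
  rw [not_lt, top_le_iff] at htop
  let leaf (s : ℝ≥0) : Set (ℝ≥0 × ℝ≥0) := Set.Ioc 1 2 ×ˢ Set.Iio s
  have hleaf (s) : MeasurableSet (leaf s) := measurableSet_Ioc.prod measurableSet_Iio
  let f (s : ℝ≥0) : ℝ≥0 × ℝ≥0 → ℝ≥0∞ := (leaf s).indicator 1
  have hf (s) : Measurable (f s) := measurable_one.indicator (hleaf s)
  have hsumf (s) : Measurable fun d : Config (ℝ≥0 × ℝ≥0) => d.sum (f s) :=
    measurable_config_sum measurable_id (F := fun _ => f s) ((hf s).comp measurable_snd)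
  let A (a : ℕ × ℕ) : Set (Config (ℝ≥0 × ℝ≥0)) := ⋃ (p : c.Index)
    (_ : c.label p = a ∧ (c.point p).1 ≤ 1), {d | d.sum (f (𝕎.S (c.point p).2)) ≠ 0}
  have hA (a) : MeasurableSet (A a) := .iUnion fun p => .iUnion fun _ =>
    (hsumf _) (measurableSet_singleton 0).compl
  have hprob (s : ℝ≥0) : min (s : ℝ≥0∞) 1 / 4 ≤ poissonLaw (lebesgue.prod lebesgue)
      {d : Config (ℝ≥0 × ℝ≥0) | d.sum (f s) ≠ 0} := by
    have hint : ∫⁻ y, f s y ∂(lebesgue.prod lebesgue) = s := by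
      rw [lintegral_indicator_one (hleaf s), Measure.prod_prod, lebesgue_Iio,
        lebesgue_Ioc _ _ one_le_two, show (2 - 1 : ℝ≥0) = 1 from tsub_eq_of_eq_add (by norm_num),
        ENNReal.coe_one, one_mul]
    have h0 : poissonLaw (lebesgue.prod lebesgue)
        {d : Config (ℝ≥0 × ℝ≥0) | d.sum (f s) ≠ 0}ᶜ ≤ 1 - min (s : ℝ≥0∞) 1 / 4 := by
      calc poissonLaw (lebesgue.prod lebesgue) {d : Config (ℝ≥0 × ℝ≥0) | d.sum (f s) ≠ 0}ᶜ
          = ∫⁻ d, {d : Config (ℝ≥0 × ℝ≥0) | d.sum (f s) ≠ 0}ᶜ.indicator 1 d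
              ∂(poissonLaw (lebesgue.prod lebesgue)) :=
            (lintegral_indicator_one ((hsumf s) (measurableSet_singleton 0).compl).compl).symm
        _ ≤ ∫⁻ d, expNeg (Config.sum d (f s)) ∂(poissonLaw (lebesgue.prod lebesgue)) := by
            refine lintegral_mono fun d => Set.indicator_apply_le' (fun hd => ?_) fun _ => zero_le
            have : Config.sum d (f s) = 0 := not_not.1 hd
            simp [this]
        _ ≤ expNeg ((s : ℝ≥0∞) / 2) := by
            rw [← hint]
            exact lintegral_expNeg_config_sum_le _ (hf s) fun y =>
              Set.indicator_apply_le' (fun _ => le_rfl) fun _ => zero_le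
        _ ≤ expNeg (min (s : ℝ≥0∞) 1 / 2) :=
            expNeg_anti (ENNReal.div_le_div_right (min_le_left _ _) _)
        _ ≤ 1 - min (s : ℝ≥0∞) 1 / 2 / 2 :=
            expNeg_le_one_sub_half (ENNReal.half_le_self.trans (min_le_right _ _))
        _ = 1 - min (s : ℝ≥0∞) 1 / 4 := by
            rw [div_eq_mul_inv, div_eq_mul_inv, div_eq_mul_inv, mul_assoc,
              ← ENNReal.mul_inv (by simp) (by simp)]
            norm_num
    have hm := prob_compl_eq_one_sub (μ := poissonLaw (lebesgue.prod lebesgue))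
      ((hsumf s) (measurableSet_singleton 0).compl).compl
    rw [compl_compl] at hm
    change poissonLaw (lebesgue.prod lebesgue) {d : Config (ℝ≥0 × ℝ≥0) | d.sum (f s) ≠ 0} = _ at hm
    rw [hm]
    have h4 : min (s : ℝ≥0∞) 1 / 4 ≤ 1 :=
      (ENNReal.div_le_of_le_mul (by
        rw [one_mul]; exact (min_le_right _ _).trans (by norm_num)))
    exact (ENNReal.sub_sub_cancel (by simp) h4).ge.trans (tsub_le_tsub_left h0 1)
  have hsum : ∑' a, poissonLaw (lebesgue.prod lebesgue) (A a) = ∞ := by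
    have h1 : Config.sum c (fun z => (Set.Iic 1).indicator 1 z.1 * min (𝕎.S z.2 : ℝ≥0∞) 1) ≤
        4 * ∑' a, poissonLaw (lebesgue.prod lebesgue) (A a) := by
      rw [← ENNReal.tsum_mul_left]
      refine le_trans (ENNReal.tsum_le_tsum fun p => ?_)
        (ENNReal.tsum_comp_le_tsum_of_injective c.label_injective
          fun a => 4 * poissonLaw (lebesgue.prod lebesgue) (A a))
      change (Set.Iic 1).indicator 1 (c.point p).1 * min (𝕎.S (c.point p).2 : ℝ≥0∞) 1 ≤ _
      by_cases hp : (c.point p).1 ≤ 1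
      · rw [Set.indicator_of_mem (show (c.point p).1 ∈ Set.Iic 1 from hp), Pi.one_apply, one_mul]
        refine (ENNReal.div_le_iff' (by simp) (by simp)).1 ((hprob _).trans ?_)
        refine measure_mono fun d hd => ?_
        simp only [A, Set.mem_iUnion]
        exact ⟨p, ⟨rfl, hp⟩, hd⟩
      · rw [Set.indicator_of_notMem (show (c.point p).1 ∉ Set.Iic 1 from hp), zero_mul]
        exact zero_le
    rw [htop, top_le_iff, ENNReal.mul_eq_top] at h1
    simpa using h1
  have hinf := ae_infinite_of_tsum_eq_top (fun _ : ℕ × ℕ =>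
    poissonLaw (lebesgue.prod lebesgue)) hA hsum
  obtain ⟨coins, hcoins⟩ := (Measure.ae_ae_of_ae_prod hc).exists
  obtain ⟨stars, hlf, hstars⟩ := ((Measure.ae_ae_of_ae_prod hcoins).and hinf).exists
  obtain ⟨dust, hr⟩ := hlf.exists
  have hF := (locallyFinite_adjacencyMeasure_iff _).1 hr 2
  refine hstars ((((hF.image Prod.fst).preimage hinj.injOn).image c.label).subset fun a ha => ?_)
  have ha' : stars a ∈ A a := ha
  simp only [A, Set.mem_iUnion] at ha'
  obtain ⟨p, ⟨rfl, hp⟩, hd⟩ := ha'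
  obtain ⟨q, hq⟩ : ∃ q : Config.Index (stars (c.label p)),
      (stars (c.label p)).point q ∈ leaf (𝕎.S (c.point p).2) := by
    by_contra hno
    push Not at hno
    exact hd (ENNReal.tsum_eq_zero.2 fun q => Set.indicator_of_notMem (hno q) _)
  refine ⟨p, ⟨((c.point p).1, ((stars (c.label p)).point q).1), ⟨?_, ?_, ?_⟩, rfl⟩, rfl⟩
  · exact (SimpleGraph.fromRel_adj _ _ _).2 ⟨(hp.trans_lt hq.1.1).ne,
      .inl (.inr (.inl ⟨p, rfl, q, hq.2, rfl⟩))⟩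
  · exact hp.trans (by norm_num)
  · simpa using hq.1.2

/-! ### Conditions (1) and (2) from local finiteness -/

/-- The expected number of neighbors up to time `1` that a point `z` has, or would have if added,
in the configuration `c`. -/
def expectedDegree (𝕎 : Data Ω) (c : Config (ℝ≥0 × Ω)) (z : ℝ≥0 × Ω) : ℝ≥0∞ :=
  c.sum (𝕎.edgeWeight 1 Set.univ Set.univ z)

lemma measurable_edgeWeight_univ (T : ℝ≥0) :
    Measurable (Function.uncurry (𝕎.edgeWeight T Set.univ Set.univ)) :=
  𝕎.measurable_edgeWeight T .univ .univ

lemma measurable_expectedDegree :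
    Measurable fun q : Config (ℝ≥0 × Ω) × (ℝ≥0 × Ω) => 𝕎.expectedDegree q.1 q.2 :=
  measurable_config_sum (C := fun q : Config (ℝ≥0 × Ω) × (ℝ≥0 × Ω) => q.1) measurable_fst
    (F := fun q => 𝕎.edgeWeight 1 Set.univ Set.univ q.2) ((𝕎.measurable_edgeWeight_univ 1).comp
      ((measurable_snd.comp measurable_fst).prodMk measurable_snd))

lemma measurable_expectedEdges : Measurable 𝕎.expectedEdges :=
  measurable_config_sum measurable_id 𝕎.measurable_expectedDegree

lemma expectedDegree_remove (c : Config (ℝ≥0 × Ω)) (p : c.Index) :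
    𝕎.expectedDegree (c.remove p) (c.point p) = 𝕎.expectedDegree c (c.point p) := by
  rw [expectedDegree, expectedDegree, c.sum_remove p, edgeWeight_self, zero_add]

/-- The effect of adding a point on the expected number of edges. -/
lemma expectedEdges_eq_remove (c : Config (ℝ≥0 × Ω)) (p : c.Index) :
    𝕎.expectedEdges c = 𝕎.expectedEdges (c.remove p) +
      2 * 𝕎.expectedDegree (c.remove p) (c.point p) := by
  have h1 : 𝕎.expectedEdges c = 𝕎.expectedDegree c (c.point p) +
      (c.remove p).sum fun z => 𝕎.edgeWeight 1 Set.univ Set.univ z (c.point p) +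
        (c.remove p).sum (𝕎.edgeWeight 1 Set.univ Set.univ z) := by
    rw [expectedEdges, c.sum_remove p]
    congr 2
    funext z
    exact c.sum_remove p _
  rw [h1, Config.sum_add, ← expectedDegree_remove, expectedEdges]
  simp_rw [𝕎.edgeWeight_comm 1 Set.univ _ (c.point p)]
  rw [← expectedDegree]
  ring

lemma lintegral_edgeWeight_univ {z : ℝ≥0 × Ω} (hz : z.1 ≤ 1) :
    ∫⁻ z', 𝕎.edgeWeight 1 Set.univ Set.univ z z' ∂(lebesgue.prod μ) = 𝕎.degW μ z.2 := by
  rw [𝕎.lintegral_edgeWeight μ 1 .univ, Set.indicator_of_mem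
    (show z ∈ Set.Iic 1 ×ˢ Set.univ from ⟨hz, trivial⟩)]
  simp [degW]

lemma lintegral_expectedDegree {z : ℝ≥0 × Ω} (hz : z.1 ≤ 1) :
    ∫⁻ c, 𝕎.expectedDegree c z ∂(poissonLaw (lebesgue.prod μ)) = 𝕎.degW μ z.2 := by
  rw [← 𝕎.lintegral_edgeWeight_univ μ hz]
  exact lintegral_config_sum _ ((𝕎.measurable_edgeWeight_univ 1).comp measurable_prodMk_left)

lemma lintegral_expNeg_expectedDegree_le {z : ℝ≥0 × Ω} (hz : z.1 ≤ 1) :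
    ∫⁻ c, expNeg (𝕎.expectedDegree c z) ∂(poissonLaw (lebesgue.prod μ)) ≤
      expNeg (𝕎.degW μ z.2 / 2) := by
  rw [← 𝕎.lintegral_edgeWeight_univ μ hz]
  exact lintegral_expNeg_config_sum_le _
    ((𝕎.measurable_edgeWeight_univ 1).comp measurable_prodMk_left)
    fun _ => 𝕎.edgeWeight_le_one _ _ _ _ _

lemma measurable_expectedDegree_left (z : ℝ≥0 × Ω) :
    Measurable fun c => 𝕎.expectedDegree c z :=
  𝕎.measurable_expectedDegree.comp (measurable_id.prodMk measurable_const)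

lemma prod_Iic_one (E : Set Ω) : (lebesgue.prod μ) (Set.Iic 1 ×ˢ E) = μ E := by
  rw [Measure.prod_prod, lebesgue_Iic, ENNReal.coe_one, one_mul]

variable {𝕎 μ}

/-- A point with infinite marginal has infinite expected degree, so there is no such point. -/
lemma ae_degW_lt_top
    (hQ : ∀ᵐ c ∂(poissonLaw (lebesgue.prod μ)), 𝕎.expectedEdges c < ∞) :
    ∀ᵐ x ∂μ, 𝕎.degW μ x < ∞ := by
  set E : Set Ω := {x | ¬ 𝕎.degW μ x < ∞} with hE
  have hEm : MeasurableSet E := (measurableSet_lt (𝕎.measurable_degW μ) measurable_const).compl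
  set U : Set (ℝ≥0 × Ω) := Set.Iic 1 ×ˢ E with hU
  have hUm : MeasurableSet U := measurableSet_Iic.prod hEm
  set V : Set ((ℝ≥0 × Ω) × Config (ℝ≥0 × Ω)) :=
    {q | q.1 ∈ U ∧ 𝕎.expectedDegree q.2 q.1 < ∞} with hV
  have hVm : MeasurableSet V := (measurable_fst hUm).inter
    (measurableSet_lt (𝕎.measurable_expectedDegree.comp measurable_swap) measurable_const)
  have hF : Measurable (Function.uncurry fun (z : ℝ≥0 × Ω) (c : Config (ℝ≥0 × Ω)) =>
      V.indicator (1 : _ × _ → ℝ≥0∞) (z, c)) :=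
    (measurable_one.indicator hVm : Measurable (V.indicator (1 : _ × _ → ℝ≥0∞)))
  have h0 := mecke_poissonLaw (lebesgue.prod μ) hF
  have hR : ∫⁻ z, ∫⁻ c, V.indicator 1 (z, c) ∂(poissonLaw (lebesgue.prod μ)) ∂(lebesgue.prod μ) =
      0 := by
    refine (lintegral_congr fun z => ?_).trans lintegral_zero
    by_cases hz : z ∈ U
    · have hdeg : 𝕎.degW μ z.2 = ∞ := not_lt_top_iff.1 hz.2
      have h1 := 𝕎.lintegral_expNeg_expectedDegree_le μ hz.1
      rw [hdeg, ENNReal.top_div_of_ne_top (by simp), expNeg_top, nonpos_iff_eq_zero] at h1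
      have h2 := ae_eq_top_of_lintegral_expNeg (𝕎.measurable_expectedDegree_left z) h1
      refine (lintegral_congr_ae ?_).trans lintegral_zero
      filter_upwards [h2] with c hc
      exact Set.indicator_of_notMem (fun h => h.2.ne hc) _
    · refine (lintegral_congr fun c => ?_).trans lintegral_zero
      exact Set.indicator_of_notMem (fun h => hz h.1) _
  rw [hR, lintegral_eq_zero_iff (measurable_tsum_remove hF)] at h0
  have h3 : ∀ᵐ c ∂(poissonLaw (lebesgue.prod μ)), Config.sum c (U.indicator 1) = 0 := by
    filter_upwards [h0, hQ] with c hc hQc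
    refine ENNReal.tsum_eq_zero.2 fun p => Set.indicator_of_notMem (fun hp => ?_) _
    have h4 : V.indicator (1 : _ × _ → ℝ≥0∞) (c.point p, c.remove p) = 0 :=
      ENNReal.tsum_eq_zero.1 hc p
    have h5 : (c.point p, c.remove p) ∈ V := by
      refine ⟨hp, ?_⟩
      change 𝕎.expectedDegree (c.remove p) (c.point p) < ∞
      rw [expectedDegree_remove]
      exact (ENNReal.le_tsum p).trans_lt hQc
    rw [Set.indicator_of_mem h5] at h4
    exact one_ne_zero h4
  have h6 := lintegral_config_sum (lebesgue.prod μ)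
    (measurable_one.indicator hUm : Measurable (U.indicator (1 : _ × _ → ℝ≥0∞)))
  rw [lintegral_congr_ae h3, lintegral_zero, lintegral_indicator_one hUm, hU, prod_Iic_one] at h6
  exact h6.symm

/-- A set `E` of features with marginals at least `20` has bounded measure: only few of the points
with features in `E` have expected degree at most `1`, and all others contribute at least `1` to the
expected number of edges. So with probability at least `1 / 2` there are at most `μ E / 8 + K` such
points, which contradicts the bound for the Laplace transform of their number if `μ E` is large. -/
lemma measure_le_of_degW_gt {K : ℕ}
    (hK : poissonLaw (lebesgue.prod μ) {c | (K : ℝ≥0∞) < 𝕎.expectedEdges c} < 1 / 4)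
    {E : Set Ω} (hEm : MeasurableSet E) (hE : ∀ x ∈ E, 20 ≤ 𝕎.degW μ x) (hfin : μ E < ∞) :
    μ E ≤ 8 * (K + 1) := by
  set P := poissonLaw (lebesgue.prod μ) with hP
  set m := μ E with hm
  by_contra hlt
  rw [not_le] at hlt
  set U : Set (ℝ≥0 × Ω) := Set.Iic 1 ×ˢ E with hU
  have hUm : MeasurableSet U := measurableSet_Iic.prod hEm
  have hνU : (lebesgue.prod μ) U = m := prod_Iic_one μ E
  set V : Set ((ℝ≥0 × Ω) × Config (ℝ≥0 × Ω)) :=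
    {q | q.1 ∈ U ∧ 𝕎.expectedDegree q.2 q.1 ≤ 1} with hV
  have hVm : MeasurableSet V := (measurable_fst hUm).inter
    (measurableSet_le (𝕎.measurable_expectedDegree.comp measurable_swap) measurable_const)
  have hF : Measurable (Function.uncurry fun (z : ℝ≥0 × Ω) (c : Config (ℝ≥0 × Ω)) =>
      V.indicator (1 : _ × _ → ℝ≥0∞) (z, c)) :=
    (measurable_one.indicator hVm : Measurable (V.indicator (1 : _ × _ → ℝ≥0∞)))
  let R (c : Config (ℝ≥0 × Ω)) : ℝ≥0∞ := c.sum (U.indicator 1)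
  let G (c : Config (ℝ≥0 × Ω)) : ℝ≥0∞ :=
    ∑' p : c.Index, V.indicator 1 (c.point p, c.remove p)
  have hGm : Measurable G := measurable_tsum_remove hF
  have hRle : ∫⁻ c, expNeg (R c) ∂P ≤ expNeg (m / 2) := by
    rw [← hνU, ← lintegral_indicator_one hUm]
    exact lintegral_expNeg_config_sum_le _ (measurable_one.indicator hUm)
      fun z => Set.indicator_apply_le' (fun _ => le_rfl) fun _ => zero_le
  have hRG (c : Config (ℝ≥0 × Ω)) : R c ≤ G c + 𝕎.expectedEdges c := by
    rw [expectedEdges, Config.sum, ← ENNReal.tsum_add]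
    refine ENNReal.tsum_le_tsum fun p => ?_
    refine Set.indicator_apply_le' (fun hp => ?_) fun _ => zero_le
    rcases le_or_gt (𝕎.expectedDegree c (c.point p)) 1 with h | h
    · have : (c.point p, c.remove p) ∈ V :=
        ⟨hp, (𝕎.expectedDegree_remove c p).trans_le h⟩
      rw [Set.indicator_of_mem this]
      exact le_self_add
    · exact h.le.trans le_add_self
  -- Here the threshold `20` enters: `exp 1 * exp (-20 / 2) = exp (-9) ≤ 1 / 32`.
  have hprob {z : ℝ≥0 × Ω} (hz : z ∈ U) : P {c | 𝕎.expectedDegree c z ≤ 1} ≤ 1 / 32 := by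
    have h1 : expNeg 1 * P {c | 𝕎.expectedDegree c z ≤ 1} ≤ expNeg 1 * expNeg 9 := by
      calc expNeg 1 * P {c | 𝕎.expectedDegree c z ≤ 1}
          ≤ expNeg 1 * P {c | expNeg 1 ≤ expNeg (𝕎.expectedDegree c z)} :=
            mul_le_mul_right (measure_mono fun c h => expNeg_anti h) _
        _ ≤ ∫⁻ c, expNeg (𝕎.expectedDegree c z) ∂P :=
            mul_meas_ge_le_lintegral
              (measurable_expNeg.comp (𝕎.measurable_expectedDegree_left z)) _
        _ ≤ expNeg (𝕎.degW μ z.2 / 2) := 𝕎.lintegral_expNeg_expectedDegree_le μ hz.1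
        _ ≤ expNeg (20 / 2) := expNeg_anti (ENNReal.div_le_div_right (hE _ hz.2) _)
        _ = expNeg 1 * expNeg 9 := by
            rw [← expNeg_add]
            congr 1
            exact ((ENNReal.eq_div_iff (by simp) (by simp)).2 (by norm_num)).symm
    have h2 : expNeg 1 ≠ 0 := by simp [expNeg_eq_zero]
    have h3 : expNeg 1 ≠ ∞ := ne_top_of_le_ne_top (by simp) (expNeg_le_one 1)
    refine ((ENNReal.mul_le_mul_iff_right h2 h3).1 h1).trans ?_
    have h9 : (9 : ℝ≥0∞) = ENNReal.ofReal 9 := by simp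
    rw [h9, expNeg_ofReal (by norm_num), one_div, ← ENNReal.ofReal_ofNat,
      ← ENNReal.ofReal_inv_of_pos (by norm_num)]
    refine ENNReal.ofReal_le_ofReal ?_
    rw [Real.exp_neg]
    refine inv_anti₀ (by norm_num) ?_
    have h4 : (2 : ℝ) ^ 9 ≤ Real.exp 1 ^ 9 :=
      pow_le_pow_left₀ (by norm_num) (by linarith [Real.add_one_le_exp (1 : ℝ)]) 9
    rw [← Real.exp_nat_mul] at h4
    norm_num at h4
    linarith
  have hGint : ∫⁻ c, G c ∂P ≤ m / 32 := by
    have h1 := mecke_poissonLaw (lebesgue.prod μ) hF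
    calc ∫⁻ c, G c ∂P
        = ∫⁻ z, ∫⁻ c, V.indicator 1 (z, c) ∂P ∂(lebesgue.prod μ) := h1
      _ ≤ ∫⁻ z, U.indicator (fun _ => 1 / 32) z ∂(lebesgue.prod μ) := by
          refine lintegral_mono fun z => ?_
          rw [lintegral_indicator_one_prodMk _ hVm]
          by_cases hz : z ∈ U
          · rw [Set.indicator_of_mem hz]
            exact (measure_mono fun c hc => hc.2).trans (hprob hz)
          · rw [Set.indicator_of_notMem hz]
            refine le_of_eq ((congrArg _ ?_).trans measure_empty)
            exact Set.eq_empty_of_forall_notMem fun c hc => hz hc.1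
      _ = m / 32 := by
          rw [lintegral_indicator_const hUm, hνU, one_div, mul_comm, ← div_eq_mul_inv]
  have hm0 : m ≠ 0 := (bot_le.trans_lt hlt).ne'
  have hG : P {c | m / 8 ≤ G c} ≤ 1 / 4 := by
    have hm8 : m / 8 ≠ 0 := (ENNReal.div_pos hm0 (by simp)).ne'
    have hm8' : m / 8 ≠ ∞ := ENNReal.div_ne_top hfin.ne (by simp)
    refine (meas_ge_le_lintegral_div hGm.aemeasurable hm8 hm8').trans ?_
    refine ENNReal.div_le_of_le_mul (hGint.trans (le_of_eq ?_))
    rw [one_div, div_eq_mul_inv, div_eq_mul_inv, mul_left_comm,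
      ← ENNReal.mul_inv (by simp) (by simp)]
    norm_num
  set B : Set (Config (ℝ≥0 × Ω)) := {c | (K : ℝ≥0∞) < 𝕎.expectedEdges c} ∪ {c | m / 8 ≤ G c}
    with hB
  have hBm : MeasurableSet B := (measurableSet_lt measurable_const 𝕎.measurable_expectedEdges).union
    (measurableSet_le measurable_const hGm)
  have hBP : P B ≤ 1 / 2 := by
    refine (measure_union_le _ _).trans ((add_le_add hK.le hG).trans (le_of_eq ?_))
    rw [ENNReal.div_add_div_same, ENNReal.div_eq_div_iff (by simp) (by simp) (by simp) (by simp)]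
    norm_num
  have hBc : 1 / 2 ≤ P Bᶜ := by
    rw [prob_compl_eq_one_sub hBm]
    refine le_trans (le_of_eq ?_) (tsub_le_tsub_left hBP 1)
    rw [one_div, ENNReal.one_sub_inv_two]
  -- on the complement of `B` there are at most `m / 8 + K` points in `U`
  have hlow : expNeg (m / 8 + K) * (1 / 2) ≤ expNeg (m / 8 + K) * expNeg 1 := by
    calc expNeg (m / 8 + K) * (1 / 2) ≤ expNeg (m / 8 + K) * P Bᶜ := by gcongr
      _ = ∫⁻ _ in Bᶜ, expNeg (m / 8 + K) ∂P := by rw [setLIntegral_const]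
      _ ≤ ∫⁻ c in Bᶜ, expNeg (R c) ∂P := by
          refine setLIntegral_mono' hBm.compl fun c hc => expNeg_anti ?_
          have h1 : G c < m / 8 := not_le.1 fun h => hc (.inr h)
          have h2 : 𝕎.expectedEdges c ≤ K := not_lt.1 fun h => hc (.inl h)
          exact (hRG c).trans (add_le_add h1.le h2)
      _ ≤ ∫⁻ c, expNeg (R c) ∂P := setLIntegral_le_lintegral _ _
      _ ≤ expNeg (m / 2) := hRle
      _ ≤ expNeg (m / 8 + K + 1) := by
          refine expNeg_anti ?_
          have h1 : (K + 1 : ℝ≥0∞) ≤ m / 8 := by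
            rw [ENNReal.le_div_iff_mul_le (by simp) (by simp), mul_comm]
            exact hlt.le
          calc m / 8 + K + 1 = m / 8 + (K + 1) := add_assoc _ _ _
            _ ≤ m / 8 + m / 8 := by gcongr
            _ ≤ m / 2 := by
              rw [ENNReal.div_add_div_same, ← two_mul, div_eq_mul_inv, div_eq_mul_inv, mul_comm 2 m,
                mul_assoc]
              gcongr
              rw [← div_eq_mul_inv]
              refine ENNReal.div_le_of_le_mul ?_
              rw [show (8 : ℝ≥0∞) = 2 * 4 by norm_num, ← mul_assoc,
                ENNReal.inv_mul_cancel (by simp) (by simp), one_mul]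
              norm_num
      _ = expNeg (m / 8 + K) * expNeg 1 := expNeg_add _ _
  have hne : m / 8 + K ≠ ∞ := ENNReal.add_ne_top.2 ⟨ENNReal.div_ne_top hfin.ne (by simp), by simp⟩
  have h12 : (1 / 2 : ℝ≥0∞) ≤ expNeg 1 :=
    (ENNReal.mul_le_mul_iff_right (fun h => hne (expNeg_eq_zero.1 h))
      (ne_top_of_le_ne_top (by simp) (expNeg_le_one _))).1 hlow
  rw [← ENNReal.ofReal_one, expNeg_ofReal zero_le_one, ENNReal.ofReal_one, one_div,
    ← ENNReal.ofReal_ofNat, ← ENNReal.ofReal_inv_of_pos (by norm_num),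
    ENNReal.ofReal_le_ofReal_iff (Real.exp_pos _).le, Real.exp_neg] at h12
  have h13 := (inv_le_inv₀ (by norm_num) (Real.exp_pos _)).1 h12
  linarith [Real.exp_one_gt_d9]

/-- Bound for the mass of `W` on features with bounded marginals. The expectation of the number of
edges, restricted to the event that it is at most `L = K + 642`, is at most `L`. By the Mecke
formula it is at least half of the mass of `W`, because the addition of two points with bounded marginals to
a configuration with at most `K` edges typically creates at most `642 = 2 * 160 + 2 * (1 + 160)`
ordered edges. -/
lemma massW_le_of_measure_expectedEdges_gt {K : ℕ}
    (hK : poissonLaw (lebesgue.prod μ) {c | (K : ℝ≥0∞) < 𝕎.expectedEdges c} < 1 / 4)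
    {B : Set Ω} (hBm : MeasurableSet B) (hB : ∀ x ∈ B, 𝕎.degW μ x ≤ 20) :
    𝕎.massW μ B B ≤ 2 * (K + 642) := by
  set P := poissonLaw (lebesgue.prod μ) with hP
  set L : ℝ≥0∞ := K + 642 with hL
  set w := 𝕎.edgeWeight 1 Set.univ Set.univ with hw
  set wB := 𝕎.edgeWeight 1 B B with hwB
  have hwm : Measurable (Function.uncurry w) := 𝕎.measurable_edgeWeight_univ 1
  have hwBm : Measurable (Function.uncurry wB) := 𝕎.measurable_edgeWeight 1 hBm hBm
  have hwBw (z z') : wB z z' ≤ w z z' := by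
    refine Set.indicator_le_indicator_of_subset (fun q hq => ?_) (fun _ => zero_le) _
    exact ⟨hq.1, ⟨hq.2.1.1, trivial⟩, hq.2.2.1, trivial⟩
  -- the configurations in which the addition of `z` leads to at most `L` expected edges
  let V₁ : Set ((ℝ≥0 × Ω) × Config (ℝ≥0 × Ω)) :=
    {q | 𝕎.expectedEdges q.2 + 2 * 𝕎.expectedDegree q.2 q.1 ≤ L}
  have hV₁ : MeasurableSet V₁ := measurableSet_le
    ((𝕎.measurable_expectedEdges.comp measurable_snd).add
      ((𝕎.measurable_expectedDegree.comp measurable_swap).const_mul 2)) measurable_const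
  -- the same for the addition of both `z` and a second point
  let V₂ (z : ℝ≥0 × Ω) : Set ((ℝ≥0 × Ω) × Config (ℝ≥0 × Ω)) :=
    {q | 𝕎.expectedEdges q.2 + 2 * 𝕎.expectedDegree q.2 q.1 +
      2 * (w z q.1 + 𝕎.expectedDegree q.2 z) ≤ L}
  have hV₂ (z) : MeasurableSet (V₂ z) := measurableSet_le
    (((𝕎.measurable_expectedEdges.comp measurable_snd).add
      ((𝕎.measurable_expectedDegree.comp measurable_swap).const_mul 2)).add
      (((hwm.comp (measurable_const.prodMk measurable_fst)).add
        ((𝕎.measurable_expectedDegree_left z).comp measurable_snd)).const_mul 2)) measurable_const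
  let F₁ (z : ℝ≥0 × Ω) (c : Config (ℝ≥0 × Ω)) : ℝ≥0∞ := c.sum (wB z) * V₁.indicator 1 (z, c)
  have hF₁ : Measurable (Function.uncurry F₁) := by
    refine Measurable.mul ?_ (measurable_one.indicator hV₁)
    exact measurable_config_sum (C := fun q : (ℝ≥0 × Ω) × Config (ℝ≥0 × Ω) => q.2) measurable_snd
      (F := fun q => wB q.1)
      (hwBm.comp ((measurable_fst.comp measurable_fst).prodMk measurable_snd))
  let F₂ (z z' : ℝ≥0 × Ω) (c : Config (ℝ≥0 × Ω)) : ℝ≥0∞ :=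
    wB z z' * (V₂ z).indicator 1 (z', c)
  have hF₂ (z) : Measurable (Function.uncurry (F₂ z)) :=
    (hwBm.comp (measurable_const.prodMk measurable_fst)).mul (measurable_one.indicator (hV₂ z))
  have hup : ∫⁻ z, ∫⁻ c, F₁ z c ∂P ∂(lebesgue.prod μ) ≤ L := by
    rw [← mecke_poissonLaw _ hF₁]
    calc ∫⁻ c, ∑' p : Config.Index c, F₁ (c.point p) (c.remove p) ∂P
        ≤ ∫⁻ _, L ∂P := by
          refine lintegral_mono fun c => ?_
          have hmem (p : Config.Index c) :
              (c.point p, c.remove p) ∈ V₁ ↔ 𝕎.expectedEdges c ≤ L := by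
            rw [𝕎.expectedEdges_eq_remove c p]; rfl
          by_cases hc : 𝕎.expectedEdges c ≤ L
          · refine le_trans (ENNReal.tsum_le_tsum fun p => ?_) hc
            simp only [F₁]
            rw [Set.indicator_of_mem ((hmem p).2 hc), Pi.one_apply, mul_one]
            exact (c.remove_sum_le p _).trans (c.sum_mono fun z' => hwBw _ _)
          · refine le_trans (le_of_eq (ENNReal.tsum_eq_zero.2 fun p => ?_)) zero_le
            simp only [F₁]
            rw [Set.indicator_of_notMem fun h => hc ((hmem p).1 h), mul_zero]
      _ = L := by simp
  have hstep (z : ℝ≥0 × Ω) :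
      ∫⁻ c, F₁ z c ∂P = ∫⁻ z', ∫⁻ c, F₂ z z' c ∂P ∂(lebesgue.prod μ) := by
    rw [← mecke_poissonLaw _ (hF₂ z)]
    refine lintegral_congr fun c => ?_
    simp only [F₁, Config.sum]
    rw [← ENNReal.tsum_mul_right]
    refine tsum_congr fun p => ?_
    have hmem : (c.point p, c.remove p) ∈ V₂ z ↔ (z, c) ∈ V₁ := by
      change _ ≤ L ↔ _ ≤ L
      rw [𝕎.expectedEdges_eq_remove c p, expectedDegree, expectedDegree, expectedDegree,
        c.sum_remove p (𝕎.edgeWeight 1 Set.univ Set.univ z)]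
    simp only [F₂]
    congr 1
    by_cases h : (z, c) ∈ V₁
    · rw [Set.indicator_of_mem h, Set.indicator_of_mem (hmem.2 h)]; rfl
    · rw [Set.indicator_of_notMem h, Set.indicator_of_notMem fun h' => h (hmem.1 h')]
  -- Markov's inequality
  have hdeg {z : ℝ≥0 × Ω} (hz : z ∈ Set.Iic 1 ×ˢ B) :
      P {c | 160 ≤ 𝕎.expectedDegree c z} ≤ 1 / 8 := by
    refine (meas_ge_le_lintegral_div (𝕎.measurable_expectedDegree_left z).aemeasurable
      (by simp) (by simp)).trans ?_
    rw [𝕎.lintegral_expectedDegree μ hz.1]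
    refine (ENNReal.div_le_div_right (hB _ hz.2) _).trans (le_of_eq ?_)
    rw [ENNReal.div_eq_div_iff (by simp) (by simp) (by simp) (by simp)]
    norm_num
  have hprob {z z' : ℝ≥0 × Ω} (hz : z ∈ Set.Iic 1 ×ˢ B) (hz' : z' ∈ Set.Iic 1 ×ˢ B) :
      1 / 2 ≤ P (Prod.mk z' ⁻¹' V₂ z) := by
    have hcompl : P (Prod.mk z' ⁻¹' V₂ z)ᶜ ≤ 1 / 2 := by
      calc P (Prod.mk z' ⁻¹' V₂ z)ᶜ
          ≤ P ({c | (K : ℝ≥0∞) < 𝕎.expectedEdges c} ∪ ({c | 160 ≤ 𝕎.expectedDegree c z'} ∪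
              {c | 160 ≤ 𝕎.expectedDegree c z})) := by
            refine measure_mono fun c hc => ?_
            by_contra hn
            simp only [Set.mem_union, Set.mem_ofPred_eq, not_or, not_lt, not_le] at hn
            obtain ⟨h1, h2, h3⟩ := hn
            refine hc ?_
            change _ ≤ L
            calc 𝕎.expectedEdges c + 2 * 𝕎.expectedDegree c z' +
                  2 * (w z z' + 𝕎.expectedDegree c z)
                ≤ K + 2 * 160 + 2 * (1 + 160) := by
                  gcongr
                  exact 𝕎.edgeWeight_le_one _ _ _ _ _
              _ = L := by rw [hL, add_assoc]; norm_num
        _ ≤ 1 / 4 + (1 / 8 + 1 / 8) := by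
            refine (measure_union_le _ _).trans (add_le_add hK.le ?_)
            exact (measure_union_le _ _).trans (add_le_add (hdeg hz') (hdeg hz))
        _ = 1 / 2 := by
            rw [ENNReal.div_add_div_same, show (1 + 1 : ℝ≥0∞) / 8 = 1 / 4 by
              rw [ENNReal.div_eq_div_iff (by simp) (by simp) (by simp) (by simp)]; norm_num,
              ENNReal.div_add_div_same,
              ENNReal.div_eq_div_iff (by simp) (by simp) (by simp) (by simp)]
            norm_num
    have hm := measurable_prodMk_left (x := z') (hV₂ z)
    have := prob_compl_eq_one_sub (μ := P) hm.compl
    rw [compl_compl] at this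
    rw [this]
    refine le_trans (le_of_eq ?_) (tsub_le_tsub_left hcompl 1)
    rw [one_div, ENNReal.one_sub_inv_two]
  have hlow : 𝕎.massW μ B B * (1 / 2) ≤ ∫⁻ z, ∫⁻ c, F₁ z c ∂P ∂(lebesgue.prod μ) := by
    have h1 := 𝕎.lintegral_lintegral_edgeWeight μ 1 hBm hBm
    rw [ENNReal.coe_one, one_mul, one_mul] at h1
    have h2 : Measurable fun z => ∫⁻ z', 𝕎.edgeWeight 1 B B z z' ∂(lebesgue.prod μ) :=
      hwBm.lintegral_prod_right'
    rw [← h1, ← lintegral_mul_const _ h2]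
    refine lintegral_mono fun z => ?_
    rw [hstep]
    have h3 : Measurable fun z' => 𝕎.edgeWeight 1 B B z z' := hwBm.comp measurable_prodMk_left
    rw [← lintegral_mul_const _ h3]
    refine lintegral_mono fun z' => ?_
    change wB z z' * (1 / 2) ≤ ∫⁻ c, wB z z' * (V₂ z).indicator 1 (z', c) ∂P
    have h4 : Measurable fun c => (V₂ z).indicator (1 : _ × _ → ℝ≥0∞) (z', c) :=
      (measurable_one.indicator (hV₂ z)).comp measurable_prodMk_left
    rw [lintegral_const_mul _ h4, lintegral_indicator_one_prodMk _ (hV₂ z)]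
    by_cases hzz : (z, z') ∈ timedPairs 1 B B
    · gcongr
      exact hprob hzz.2.1 hzz.2.2
    · rw [show wB z z' = 0 from Set.indicator_of_notMem hzz _, zero_mul]
      exact zero_le
  have h3 := hlow.trans hup
  rw [one_div, ← div_eq_mul_inv] at h3
  rw [mul_comm]
  exact (ENNReal.div_le_iff (by simp) (by simp)).1 h3

lemma lintegral_min_S_lt_top_of_ae
    (h : ∀ᵐ c ∂(poissonLaw (lebesgue.prod μ)), Config.sum c (fun z =>
      (Set.Iic 1).indicator 1 z.1 * min (𝕎.S z.2 : ℝ≥0∞) 1) < ∞) :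
    ∫⁻ x, min (𝕎.S x : ℝ≥0∞) 1 ∂μ < ∞ := by
  by_contra htop
  rw [not_lt, top_le_iff] at htop
  have hm1 : Measurable ((Set.Iic 1).indicator (1 : ℝ≥0 → ℝ≥0∞)) :=
    measurable_one.indicator measurableSet_Iic
  have hm2 : Measurable fun x => min (𝕎.S x : ℝ≥0∞) 1 := 𝕎.measurable_coe_S.min measurable_const
  set f : ℝ≥0 × Ω → ℝ≥0∞ := fun z =>
    (Set.Iic 1).indicator 1 z.1 * min (𝕎.S z.2 : ℝ≥0∞) 1 with hf
  have hfm : Measurable f := (hm1.comp measurable_fst).mul (hm2.comp measurable_snd)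
  have hint : ∫⁻ z, f z ∂(lebesgue.prod μ) = ∞ := by
    rw [hf, lintegral_prod_mul hm1.aemeasurable hm2.aemeasurable,
      lintegral_indicator_one measurableSet_Iic, lebesgue_Iic, htop, ENNReal.coe_one, one_mul]
  have h1 := lintegral_expNeg_config_sum_le (lebesgue.prod μ) hfm fun z => mul_le_one'
    (Set.indicator_apply_le' (fun _ => le_rfl) fun _ => zero_le) (min_le_right _ _)
  rw [hint, ENNReal.top_div_of_ne_top (by simp), expNeg_top, nonpos_iff_eq_zero] at h1
  have h2 := ae_eq_top_of_lintegral_expNeg (measurable_config_sum measurable_id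
    (F := fun _ => f) (hfm.comp measurable_snd)) h1
  obtain ⟨c, hc, hc'⟩ := (h.and h2).exists
  exact hc.ne hc'

theorem locallyFinite_of_ae
    (h : ∀ᵐ ω ∂(𝕎.sampleLaw μ), LocallyFiniteMeasure (adjacencyMeasure (𝕎.graph ω))) :
    𝕎.LocallyFinite₁ μ ∧ 𝕎.LocallyFinite₂ μ := by
  have hQ := 𝕎.ae_expectedEdges_lt_top μ h
  obtain ⟨K, hK⟩ := exists_nat_measure_gt_lt _ 𝕎.measurable_expectedEdges hQ
    (ε := 1 / 4) (by simp)
  refine ⟨(𝕎.locallyFinite₁_iff μ).2 (ae_degW_lt_top hQ), ?_⟩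
  refine locallyFinite₂_of_degW (D := 20)
    (lintegral_min_S_lt_top_of_ae (𝕎.ae_sum_min_S_lt_top μ h)) ?_ ?_
  · by_contra htop
    rw [not_lt, top_le_iff] at htop
    obtain ⟨E, hEm, hE, hlt, hfin⟩ := Measure.exists_subset_measure_lt_top (μ := μ)
      (measurableSet_lt measurable_const (𝕎.measurable_degW μ))
      (r := 8 * (K + 1)) (htop ▸ ENNReal.mul_lt_top (by simp) (by simp))
    refine absurd hlt (not_lt.2 (measure_le_of_degW_gt hK hEm (fun x hx => ?_) hfin))
    exact le_of_lt (show ((20 : ℝ≥0) : ℝ≥0∞) < 𝕎.degW μ x from hE hx)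
  · refine (massW_le_of_measure_expectedEdges_gt hK
      (measurableSet_le (𝕎.measurable_degW μ) measurable_const)
      fun x hx => hx).trans_lt ?_
    exact ENNReal.mul_lt_top (by simp) (by simp)

end Data

end Graphex

end

theorem mainTheorem8 {Ω : Type*} [MeasurableSpace Ω] (μ : Measure Ω) [SigmaFinite μ]
    (𝕎 : Graphex.Data Ω) :
    ((𝕎.LocallyFinite₁ μ ∧ 𝕎.LocallyFinite₂ μ) ↔
      ∀ᵐ ω ∂(𝕎.sampleLaw μ),
        Graphex.LocallyFiniteMeasure (Graphex.adjacencyMeasure (𝕎.graph ω))) ∧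
    (𝕎.LocallyFinite₁ μ →
      List.TFAE [
        𝕎.LocallyFinite₂ μ,
        ∀ D : ℝ≥0, 0 < D →
          μ {x | (D : ℝ≥0∞) < 𝕎.deg μ x} < ∞ ∧
          (𝕎.restrict {x | 𝕎.deg μ x ≤ D}).IsIntegrable (μ.comap (↑)),
        ∃ D : ℝ≥0, 0 < D ∧
          μ {x | (D : ℝ≥0∞) < 𝕎.deg μ x} < ∞ ∧
          (𝕎.restrict {x | 𝕎.deg μ x ≤ D}).IsIntegrable (μ.comap (↑)),
        ∀ D : ℝ≥0, 0 < D →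
          μ {x | (D : ℝ≥0∞) < 𝕎.degW μ x} < ∞ ∧
          (𝕎.restrict {x | 𝕎.degW μ x ≤ D}).GraphonIntegrable (μ.comap (↑)) ∧
          Integrable (fun x => min (𝕎.S x : ℝ) 1) μ,
        ∃ D : ℝ≥0, 0 < D ∧
          μ {x | (D : ℝ≥0∞) < 𝕎.degW μ x} < ∞ ∧
          (𝕎.restrict {x | 𝕎.degW μ x ≤ D}).GraphonIntegrable (μ.comap (↑)) ∧
          Integrable (fun x => min (𝕎.S x : ℝ) 1) μ]) := by
  refine ⟨⟨fun h => 𝕎.ae_locallyFinite μ h.1 h.2, fun h => Graphex.Data.locallyFinite_of_ae h⟩,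
    fun h₁ => Graphex.Data.tfae_locallyFinite₂ h₁⟩
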